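/- Let $\mathbb K=\mathbb R$ or $\mathbb C$. A graded symplectic space is a finite-dimensional $\mathbb K$-vector space $V$ with a symplectic form $\sigma$ and a grading $V=\bigoplus_i V_i$, indexed either by $\mathbb Z$ or by $\tfrac12\mathbb Z_{\rm odd}:=\{k+\tfrac12: k\in\mathbb Z\}$, such that $\sigma(V_i,V_j)=0$ whenever $i+j\neq0$. An endomorphism $\delta$ of $V$ has degree $-1$ if $\delta(V_i)\subset V_{i-1}$ for all $i$, and $\delta\in\mathfrak{sp}(V)$ if $\sigma(\delta x,y)+\sigma(x,\delta y)=0$ for all $x,y$. Endomorphisms of graded symplectic spaces are called conjugate if they are intertwined by a linear isomorphism preserving the symplectic forms and the gradings. Direct sums of graded symplectic spaces are taken degree by degree, with skew-orthogonal summands, and endomorphisms are summed accordingly. Consider the following blocks. * For $s\in\tfrac12\mathbb Z$, $s\ge0$, and an integer $0\le l\le 2[s]$ (where $[s]$ is the integer part), $\delta^{\mathfrak{sp}}_{s;l}$ acts on the space with basis $e_{s-l},\dots,e_s,f_{-s},\dots,f_{l-s}$ (the index is the degree), with $\sigma(e_i,e_j)=\sigma(f_i,f_j)=0$, $\sigma(e_i,f_{-i})=(-1)^{s-i}$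 and $\sigma(e_i,f_j)=0$ for $j\ne -i$, by $e_i\mapsto e_{i-1}$ for $i>s-l$, $e_{s-l}\mapsto0$, $f_i\mapsto f_{i-1}$ for $i>-s$, $f_{-s}\mapsto 0$. * For positive $m\in\tfrac12\mathbb Z_{\rm odd}$, $\tau^{\mathfrak{sp}}_m$ acts on the space with basis $\varepsilon_{m},\varepsilon_{m-1},\dots,\varepsilon_{-m}$ (the index is the degree), with $\sigma(\varepsilon_i,\varepsilon_j)=0$ for $j\neq-i$, $\sigma(\varepsilon_{i},\varepsilon_{-i})=(-1)^{i+1/2}$, by $\varepsilon_i\mapsto\varepsilon_{i-1}$ for $i>-m$ and $\varepsilon_{-m}\mapsto0$; thus $\sigma(\tau^{\mathfrak{sp}}_m\varepsilon_{1/2},\varepsilon_{1/2})=1>0$. The block $-\tau_m^{\mathfrak{sp}}$ is the negative of this endomorphism on the same graded symplectic space. **Theorem.** Let $V$ be a graded symplectic space. 1. If the grading is indexed by $\mathbb Z$, then every degree $-1$ element of $\mathfrak{sp}(V)$ is conjugate to a direct sum of blocks $\delta^{\mathfrak{sp}}_{s;l}$ with $s$ a nonnegative integer and $0\le l\le 2s$.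 2. If the grading is indexed by $\tfrac12\mathbb Z_{\rm odd}$ and $\mathbb K=\mathbb C$, then every degree $-1$ element of $\mathfrak{sp}(V)$ is conjugate to a direct sum of blocks $\delta^{\mathfrak{sp}}_{s;l}$ with $s\in\tfrac12\mathbb Z_{\rm odd}$, $s>0$, $0\le l\le 2s-1$, and $\tau^{\mathfrak{sp}}_m$ with $m\in\tfrac12\mathbb Z_{\rm odd}$, $m>0$. 3. If the grading is indexed by $\tfrac12\mathbb Z_{\rm odd}$ and $\mathbb K=\mathbb R$, then every degree $-1$ element of $\mathfrak{sp}(V)$ is conjugate to a direct sum of blocks $\delta^{\mathfrak{sp}}_{s;l}$, $\tau^{\mathfrak{sp}}_m$ and $-\tau^{\mathfrak{sp}}_m$, with $s,l,m$ in the same ranges as in 2. In each case the number of appearances of each block is an invariant of the conjugacy class: if two degree $-1$ elements of $\mathfrak{sp}(V)$ are conjugate to direct sums of the blocks listed for that case, then they are conjugate to each other if and only if each block appears the same number of times in the two sums. -/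

import Mathlib

/-- A graded symplectic space: a symplectic form on `V` (bilinear, alternating, nondegenerate)
together with a grading `V = ⨁ i, V_i` in which `V_i` and `V_j` are skew-orthogonal unless
`i + j = 0`.  The degrees are rational numbers; they are restricted to the integers or to the
half-odd integers by `GradedSymplecticSpace.DegreesIn`. -/
structure GradedSymplecticSpace (K V : Type*) [Field K] [AddCommGroup V] [Module K V] where
  form : V →ₗ[K] V →ₗ[K] K
  isAlt : form.IsAlt
  nondegenerate : form.Nondegenerate
  component : ℚ → Submodule K V
  isInternal : DirectSum.IsInternal component
  form_eq_zero : ∀ i j : ℚ, i + j ≠ 0 → ∀ x ∈ component i, ∀ y ∈ component j, form x y = 0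

namespace GradedSymplecticSpace

section General

variable {K V W : Type*} [Field K] [AddCommGroup V] [Module K V] [AddCommGroup W] [Module K W]

/-- All nonzero graded components have degree in `D`, i.e. the grading is indexed by `D`. -/
def DegreesIn (S : GradedSymplecticSpace K V) (D : Set ℚ) : Prop :=
  ∀ i : ℚ, i ∉ D → S.component i = ⊥

/-- The set of endomorphisms of degree `-1` in the symplectic Lie algebra `𝔰𝔭(V)`. -/
def spDegreeNegOne (S : GradedSymplecticSpace K V) : Set (Module.End K V) :=
  {δ | δ ∈ skewAdjointLieSubalgebra S.form ∧
    ∀ i : ℚ, ∀ x ∈ S.component i, δ x ∈ S.component (i - 1)}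

/-- Conjugacy of an endomorphism `δ` of `V` and an endomorphism `ε` of `W` by a linear
isomorphism that preserves the symplectic forms and the gradings. -/
def IsConj (S : GradedSymplecticSpace K V) (δ : Module.End K V)
    (T : GradedSymplecticSpace K W) (ε : Module.End K W) : Prop :=
  ∃ φ : V ≃ₗ[K] W,
    (∀ x y : V, T.form (φ x) (φ y) = S.form x y) ∧
    (∀ i : ℚ, (S.component i).map (φ : V →ₗ[K] W) = T.component i) ∧
    (∀ x : V, φ (δ x) = ε (φ x))

end General

section DirectSum

variable {K J : Type*} [Field K] [Fintype J] {V : J → Type*}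
  [∀ j, AddCommGroup (V j)] [∀ j, Module K (V j)]

/-- The direct sum of finitely many graded symplectic spaces: the summands are mutually
skew-orthogonal, and the component of degree `i` of the sum is the sum of the components
of degree `i`. -/
def directSum (S : ∀ j, GradedSymplecticSpace K (V j)) :
    GradedSymplecticSpace K (∀ j, V j) where
  form := LinearMap.mk₂ K (fun x y => ∑ j, (S j).form (x j) (y j))
    (by intros; simp [Finset.sum_add_distrib])
    (by intros; simp [Finset.mul_sum])
    (by intros; simp [Finset.sum_add_distrib])
    (by intros; simp [Finset.mul_sum])
  isAlt := fun x => by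
    simp only [LinearMap.mk₂_apply]
    exact Finset.sum_eq_zero fun j _ => (S j).isAlt (x j)
  nondegenerate := by
    classical
    constructor
    · intro x hx
      funext j
      refine (S j).nondegenerate.1 _ fun y => ?_
      have h := hx (Pi.single j y)
      rw [LinearMap.mk₂_apply, Finset.sum_eq_single j] at h
      · simpa using h
      · intro k _ hk
        simp [Pi.single_eq_of_ne hk]
      · simp
    · intro y hy
      funext j
      refine (S j).nondegenerate.2 _ fun x => ?_
      have h := hy (Pi.single j x)
      rw [LinearMap.mk₂_apply, Finset.sum_eq_single j] at h
      · simpa using h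
      · intro k _ hk
        simp [Pi.single_eq_of_ne hk]
      · simp
  component := fun i => Submodule.pi Set.univ fun j => (S j).component i
  isInternal := by
    classical
    rw [DirectSum.isInternal_submodule_iff_iSupIndep_and_iSup_eq_top]
    constructor
    · rw [iSupIndep_def]
      intro i
      have hle : (⨆ k, ⨆ _ : k ≠ i, Submodule.pi Set.univ fun j => (S j).component k) ≤
          Submodule.pi Set.univ fun j => ⨆ k, ⨆ _ : k ≠ i, (S j).component k := by
        refine iSup₂_le fun k hk x hx j hj => ?_
        exact (le_iSup₂_of_le (f := fun k (_ : k ≠ i) => (S j).component k) k hk le_rfl)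
          (hx j hj)
      rw [Submodule.disjoint_def]
      intro x hx hx'
      funext j
      have hd := iSupIndep_def.1 (S j).isInternal.submodule_iSupIndep i
      exact (Submodule.disjoint_def.1 hd) _ (hx j trivial) (hle hx' j trivial)
    · rw [eq_top_iff]
      intro x _
      rw [← Finset.univ_sum_single x]
      refine Submodule.sum_mem _ fun j _ => ?_
      have hj : x j ∈ ⨆ i, (S j).component i := by
        rw [(S j).isInternal.submodule_iSup_eq_top]; trivial
      have hmap := Submodule.mem_map_of_mem (f := LinearMap.single K V j) hj
      rw [Submodule.map_iSup] at hmap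
      have hle : ∀ i, ((S j).component i).map (LinearMap.single K V j) ≤
          Submodule.pi Set.univ fun j => (S j).component i := by
        rintro i _ ⟨y, hy, rfl⟩ k _
        by_cases hk : k = j
        · subst hk; simpa using hy
        · simp [Pi.single_eq_of_ne hk]
      exact iSup_mono hle hmap
  form_eq_zero := by
    intro i k hik x hx y hy
    rw [LinearMap.mk₂_apply]
    exact Finset.sum_eq_zero fun j _ =>
      (S j).form_eq_zero i k hik _ (hx j trivial) _ (hy j trivial)

/-- The direct sum of endomorphisms, acting on each summand separately. -/
def directSumEnd (δ : ∀ j, Module.End K (V j)) : Module.End K (∀ j, V j) :=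
  LinearMap.pi fun j => δ j ∘ₗ LinearMap.proj j

end DirectSum

/-- The space with basis `(e_a)`, `a ∈ I`, in which `e_a` has degree `deg a` and
`σ(e_a, e_b) = sgn a` if `b = inv a`, `σ(e_a, e_b) = 0` otherwise. -/
def ofBasis (K : Type*) [Field K] [CharZero K] {I : Type*} [Fintype I] (deg : I → ℚ)
    (inv : I → I) (sgn : I → ℤ) (inv_inv : ∀ a, inv (inv a) = a) (sgn_ne : ∀ a, sgn a ≠ 0)
    (sgn_inv : ∀ a, sgn (inv a) = - sgn a) (deg_inv : ∀ a, deg (inv a) = - deg a) :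
    GradedSymplecticSpace K (I → K) where
  form := LinearMap.mk₂ K (fun x y => ∑ a, (sgn a : K) * (x a * y (inv a)))
    (by intros; simp [← Finset.sum_add_distrib]; congr; ext; ring)
    (by intros; simp [Finset.mul_sum]; congr; ext; ring)
    (by intros; simp [← Finset.sum_add_distrib]; congr; ext; ring)
    (by intros; simp [Finset.mul_sum]; congr; ext; ring)
  isAlt := fun x => by
    rw [LinearMap.mk₂_apply]
    have h : ∑ a, (sgn a : K) * (x a * x (inv a)) = - ∑ a, (sgn a : K) * (x a * x (inv a)) := by
      rw [← Finset.sum_neg_distrib]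
      refine Fintype.sum_equiv (Function.Involutive.toPerm inv inv_inv) _ _ fun a => ?_
      change _ = -((sgn (inv a) : K) * (x (inv a) * x (inv (inv a))))
      rw [inv_inv, sgn_inv]
      push_cast
      ring
    exact CharZero.eq_neg_self_iff.1 h
  nondegenerate := by
    classical
    constructor
    · intro x hx
      funext a
      have h := hx (Pi.single (inv a) 1)
      rw [LinearMap.mk₂_apply, Finset.sum_eq_single a] at h
      · simpa [sgn_ne a] using h
      · intro b _ hb
        have hb' : inv b ≠ inv a := fun e => hb (by rw [← inv_inv b, e, inv_inv])
        simp [Pi.single_eq_of_ne hb']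
      · simp
    · intro y hy
      funext a
      have h := hy (Pi.single (inv a) 1)
      rw [LinearMap.mk₂_apply, Finset.sum_eq_single (inv a)] at h
      · simpa [sgn_ne (inv a), inv_inv] using h
      · intro b _ hb
        simp [Pi.single_eq_of_ne hb]
      · simp
  component := fun i =>
    { carrier := {x | ∀ a, x a ≠ 0 → deg a = i}
      zero_mem' := fun a h => absurd rfl h
      add_mem' := fun {x y} hx hy a h => by
        by_cases hxa : x a = 0
        · exact hy a fun hya => h (by simp [hxa, hya])
        · exact hx a hxa
      smul_mem' := fun c x hx a h => hx a fun hxa => h (by simp [hxa]) }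
  isInternal := by
    classical
    rw [DirectSum.isInternal_submodule_iff_iSupIndep_and_iSup_eq_top]
    constructor
    · rw [iSupIndep_def]
      intro i
      rw [Submodule.disjoint_def]
      intro x hx hx'
      let P : Submodule K (I → K) :=
        Submodule.pi {a | deg a = i} fun _ => ⊥
      have hP : x ∈ P := by
        refine (iSup₂_le fun k hk z hz a ha => ?_ : _ ≤ P) hx'
        by_contra h
        exact hk ((hz a h).symm.trans ha)
      funext a
      by_contra h
      exact h (hP a (hx a h))
    · rw [eq_top_iff]
      intro x _
      rw [← Finset.univ_sum_single x]
      refine Submodule.sum_mem _ fun a _ => Submodule.mem_iSup_of_mem (deg a) ?_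
      intro b hb
      by_contra h
      exact hb (Pi.single_eq_of_ne (fun e => h (by rw [e])) _)
  form_eq_zero := by
    intro i j hij x hx y hy
    rw [LinearMap.mk₂_apply]
    refine Finset.sum_eq_zero fun a _ => ?_
    by_contra h
    have h1 : x a ≠ 0 := fun e => h (by simp [e])
    have h2 : y (inv a) ≠ 0 := fun e => h (by simp [e])
    apply hij
    rw [← hx a h1, ← hy _ h2, deg_inv, add_neg_cancel]

/-- The endomorphism with `e_a ↦ c • e_b` if `next a = some b`, and `e_a ↦ 0` if
`next a = none`. -/
noncomputable def ofBasisEnd (K : Type*) [Field K] {I : Type*} [Fintype I] [DecidableEq I]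
    (next : I → Option I) (c : ℤ) : Module.End K (I → K) :=
  (Pi.basisFun K I).constr K fun a => (next a).elim 0 fun b => Pi.single b (c : K)

theorem ofBasis_form {K I : Type*} [Field K] [CharZero K] [Fintype I] [DecidableEq I] (deg : I → ℚ)
    (inv : I → I) (sgn : I → ℤ) (h1 h2 h3 h4) (a b : I) (u v : K) :
    (ofBasis K deg inv sgn h1 h2 h3 h4).form (Pi.single a u) (Pi.single b v) =
      if inv a = b then (sgn a : K) * (u * v) else 0 := by
  change ∑ c, (sgn c : K) * ((Pi.single a u : I → K) c * (Pi.single b v : I → K) (inv c)) = _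
  rw [Finset.sum_eq_single a]
  · simp [Pi.single_apply]
  · intro c _ hc; simp [Pi.single_eq_of_ne hc]
  · simp
theorem ofBasisEnd_single {K I : Type*} [Field K] [Fintype I] [DecidableEq I] (next : I → Option I) (c : ℤ) (a : I) :
    ofBasisEnd K next c (Pi.single a 1) = (next a).elim 0 fun b => Pi.single b (c : K) := by
  have := (Pi.basisFun K I).constr_basis K (fun a => (next a).elim 0 fun b => Pi.single b (c : K)) a
  rw [ofBasisEnd, ← this, Pi.basisFun_apply]

theorem ofBasisEnd_mem {K I : Type*} [Field K] [CharZero K] [Fintype I] [DecidableEq I] (deg : I → ℚ)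
    (inv : I → I) (sgn : I → ℤ) (h1 h2 h3 h4) (next : I → Option I) (c : ℤ)
    (hdeg : ∀ a b, next a = some b → deg b = deg a - 1)
    (hsgn : ∀ a b, next a = some b → sgn b = - sgn a)
    (hnext : ∀ a b, next a = some b → next (inv b) = some (inv a)) :
    ofBasisEnd K next c ∈ (ofBasis K deg inv sgn h1 h2 h3 h4).spDegreeNegOne := by
  have hs := ofBasisEnd_single (K := K) next c
  have hf := ofBasis_form (K := K) deg inv sgn h1 h2 h3 h4
  constructor
  · have key : (ofBasis K deg inv sgn h1 h2 h3 h4).form ∘ₗ ofBasisEnd K next c =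
        (ofBasis K deg inv sgn h1 h2 h3 h4).form.compl₂ (-ofBasisEnd K next c) := by
      refine (Pi.basisFun K I).ext fun a => (Pi.basisFun K I).ext fun d => ?_
      simp only [Pi.basisFun_apply, LinearMap.comp_apply, LinearMap.compl₂_apply,
        LinearMap.neg_apply, map_neg, hs]
      rcases ha : next a with _ | b <;> rcases hd : next d with _ | e <;>
        simp only [Option.elim, map_zero, LinearMap.zero_apply, neg_zero, hf]
      · have : inv a ≠ e := by
          rintro rfl
          have := hnext _ _ hd
          rw [h1, ha] at this; cases this
        simp [this]
      · have : inv b ≠ d := by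
          rintro rfl
          have := hnext _ _ ha
          rw [this] at hd; cases hd
        simp [this]
      · have : inv b = d ↔ inv a = e := by
          constructor
          · rintro rfl
            have := hnext _ _ ha
            rw [this] at hd; exact Option.some.inj hd
          · rintro rfl
            have := hnext _ _ hd
            rw [h1, ha] at this; rw [Option.some.inj this, h1]
        simp only [this, hsgn a b ha]
        split_ifs <;> simp
    intro x y
    simpa using LinearMap.congr_fun (LinearMap.congr_fun key x) y
  · intro i x hx
    rw [← Finset.univ_sum_single x, map_sum]
    refine Submodule.sum_mem _ fun a _ => ?_
    rw [show (Pi.single a (x a) : I → K) = x a • Pi.single a 1 by simp [← Pi.single_smul], map_smul, hs]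
    by_cases hxa : x a = 0
    · simp [hxa]
    refine Submodule.smul_mem _ _ ?_
    rcases ha : next a with _ | b
    · exact Submodule.zero_mem _
    · intro d hd
      have : d = b := by
        by_contra h; exact hd (Pi.single_eq_of_ne h _)
      rw [this, hdeg a b ha, hx a hxa]

end GradedSymplecticSpace

/-- Labels of the indecomposable blocks: `delta s l` stands for `δ_{s;l}`, and `tau p`, `negTau p`
stand for `τ_m`, `-τ_m` with `m = p + 1/2`. -/
inductive BlockLabel : Type
  | delta (s : ℚ) (l : ℕ)
  | tau (p : ℕ)
  | negTau (p : ℕ)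

namespace BlockLabel

/-- The set indexing the basis of a block.  For `delta s l`, the element `inl a` stands for the
vector `e_{s-a}` and `inr a` for the vector `f_{l-s-a}`, where `0 ≤ a ≤ l`.  For `tau p` and
`negTau p`, with `m = p + 1/2`, the element `a` stands for a generator of `E_{m-a}`, where
`0 ≤ a ≤ 2m = 2p + 1`. -/
abbrev Index : BlockLabel → Type
  | delta _ l => Fin (l + 1) ⊕ Fin (l + 1)
  | tau p => Fin (2 * p + 2)
  | negTau p => Fin (2 * p + 2)

instance instFintypeIndex : ∀ b : BlockLabel, Fintype b.Index
  | delta _ l => inferInstanceAs (Fintype (Fin (l + 1) ⊕ Fin (l + 1)))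
  | tau p => inferInstanceAs (Fintype (Fin (2 * p + 2)))
  | negTau p => inferInstanceAs (Fintype (Fin (2 * p + 2)))

instance instDecidableEqIndex : ∀ b : BlockLabel, DecidableEq b.Index
  | delta _ l => inferInstanceAs (DecidableEq (Fin (l + 1) ⊕ Fin (l + 1)))
  | tau p => inferInstanceAs (DecidableEq (Fin (2 * p + 2)))
  | negTau p => inferInstanceAs (DecidableEq (Fin (2 * p + 2)))

/-- The degree of a basis vector. -/
def deg : ∀ b : BlockLabel, b.Index → ℚ
  | delta s _, Sum.inl a => s - (a : ℕ)
  | delta s l, Sum.inr a => l - s - (a : ℕ)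
  | tau p, a => (p : ℚ) + 1 / 2 - (a.val : ℕ)
  | negTau p, a => (p : ℚ) + 1 / 2 - (a.val : ℕ)

/-- The index of the only basis vector of a block that is not skew-orthogonal to the given one;
the degrees of the two vectors are opposite. -/
def inv : ∀ b : BlockLabel, b.Index → b.Index
  | delta _ _, Sum.inl a => Sum.inr a.rev
  | delta _ _, Sum.inr a => Sum.inl a.rev
  | tau _, a => Fin.rev a
  | negTau _, a => Fin.rev a

/-- The value of the symplectic form on a basis vector and its partner.  For `delta s l` it is
`σ(e_i, f_{-i}) = (-1)^(s-i)`.  For `tau p` the sign is chosen in such a way that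
`σ(τ e, e) = 1` for the basis vector `e` of degree `1/2`. -/
def sgn : ∀ b : BlockLabel, b.Index → ℤ
  | delta _ _, Sum.inl a => (-1) ^ (a : ℕ)
  | delta _ _, Sum.inr a => - (-1) ^ (a.rev : ℕ)
  | tau p, a => (-1) ^ (a.val + p + 1)
  | negTau p, a => (-1) ^ (a.val + p + 1)

/-- The graded symplectic space of a block. -/
def space (K : Type*) [Field K] [CharZero K] (b : BlockLabel) :
    GradedSymplecticSpace K (b.Index → K) :=
  GradedSymplecticSpace.ofBasis K b.deg b.inv b.sgn
    (by
      rcases b with ⟨s, l⟩ | p | p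
      · rintro (a | a) <;> simp [inv]
      · intro a; simp [inv]
      · intro a; simp [inv])
    (by
      rcases b with ⟨s, l⟩ | p | p
      · rintro (a | a) <;> simp [sgn]
      · intro a; simp [sgn]
      · intro a; simp [sgn])
    (by
      have key : ∀ (p : ℕ) (a : Fin (2 * p + 2)),
          (-1 : ℤ) ^ ((Fin.rev a).val + p + 1) = - (-1) ^ (a.val + p + 1) := by
        intro p a
        have h : (Fin.rev a).val + a.val = 2 * p + 1 := by rw [Fin.val_rev]; omega
        generalize (Fin.rev a).val = r at h
        rcases Nat.even_or_odd a.val with ha | ha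
        · have hr : Odd r := by grind
          simp [pow_add, ha.neg_one_pow, hr.neg_one_pow]
        · have hr : Even r := by grind
          simp [pow_add, ha.neg_one_pow, hr.neg_one_pow]
      rcases b with ⟨s, l⟩ | p | p
      · rintro (a | a) <;> simp [sgn, inv]
      · exact key p
      · exact key p)
    (by
      have key : ∀ (n : ℕ) (a : Fin (n + 1)), ((Fin.rev a).val : ℚ) = n - a.val := by
        intro n a
        have h : (Fin.rev a).val + a.val = n := by rw [Fin.val_rev]; omega
        have h' : ((Fin.rev a).val : ℚ) + a.val = n := by exact_mod_cast h
        linarith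
      rcases b with ⟨s, l⟩ | p | p
      · rintro (a | a) <;> simp only [deg, inv, key] <;> ring
      · intro a; simp only [deg, inv, key (2 * p + 1)]; push_cast; ring
      · intro a; simp only [deg, inv, key (2 * p + 1)]; push_cast; ring)

/-- The successor of an index in `{0, …, n - 1}`, if there is one. -/
def finNext {n : ℕ} (a : Fin n) : Option (Fin n) :=
  if h : a.val + 1 < n then some ⟨a.val + 1, h⟩ else none

/-- The basis vector to which the endomorphism of a block sends a given basis vector, up to sign:
`e_i` is followed by `e_{i-1}`, `f_i` by `f_{i-1}`, the generator of `E_i` by the generator of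
`E_{i-1}`, and the last vector of each row is sent to `0`. -/
def next : ∀ b : BlockLabel, b.Index → Option b.Index
  | delta _ _, Sum.inl a => (finNext a).map Sum.inl
  | delta _ _, Sum.inr a => (finNext a).map Sum.inr
  | tau _, a => finNext a
  | negTau _, a => finNext a

/-- The sign of the endomorphism of a block. -/
def coeff : BlockLabel → ℤ
  | delta _ _ => 1
  | tau _ => 1
  | negTau _ => -1

/-- The endomorphism `δ_{s;l}`, `τ_m` or `-τ_m` of the space of a block. -/
noncomputable def endo (K : Type*) [Field K] (b : BlockLabel) : Module.End K (b.Index → K) :=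
  GradedSymplecticSpace.ofBasisEnd K b.next b.coeff

theorem finNext_eq {n : ℕ} (a b : Fin n) : finNext a = some b ↔ b.val = a.val + 1 := by
  unfold finNext; split_ifs with h
  · simp [Fin.ext_iff, eq_comm]
  · simp; omega

/-- The endomorphism of a block is a degree `-1` element of the symplectic algebra. -/
theorem endo_mem {K : Type*} [Field K] [CharZero K] (b : BlockLabel) :
    b.endo K ∈ (b.space K).spDegreeNegOne := by
  apply GradedSymplecticSpace.ofBasisEnd_mem
  · rcases b with ⟨s, l⟩ | p | p
    · rintro (a | a) (c | c) h <;> simp [next, finNext_eq] at h <;> simp [deg, h] <;> ring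
    · intro a c h; simp [next, finNext_eq] at h; simp [deg, h]; ring
    · intro a c h; simp [next, finNext_eq] at h; simp [deg, h]; ring
  · rcases b with ⟨s, l⟩ | p | p
    · rintro (a | a) (c | c) h <;> simp [next, finNext_eq] at h
      · simp [sgn, h, pow_succ]
      · have : a.rev.val = c.rev.val + 1 := by simp only [Fin.val_rev]; omega
        simp only [sgn, this]; ring
    · intro a c h; simp [next, finNext_eq] at h; simp [sgn, h]; ring
    · intro a c h; simp [next, finNext_eq] at h; simp [sgn, h]; ring
  · rcases b with ⟨s, l⟩ | p | p
    · rintro (a | a) (c | c) h <;> simp [next, finNext_eq] at h <;> simp [next, inv, finNext_eq] <;> omega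
    · intro a c h; simp only [next, finNext_eq] at h; simp only [next, BlockLabel.inv, finNext_eq, Fin.val_rev]; omega
    · intro a c h; simp only [next, finNext_eq] at h; simp only [next, BlockLabel.inv, finNext_eq, Fin.val_rev]; omega

/-- Labels `δ_{s;l}` with `s` a nonnegative integer and `0 ≤ l ≤ 2s`. -/
def integerLabels : Set BlockLabel :=
  {b | ∃ k l : ℕ, l ≤ 2 * k ∧ b = delta (k : ℚ) l}

/-- Labels `δ_{s;l}` with `s = k + 1/2` a positive half-odd integer and `0 ≤ l ≤ 2s - 1 = 2k`. -/
def halfOddDeltaLabels : Set BlockLabel :=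
  {b | ∃ k l : ℕ, l ≤ 2 * k ∧ b = delta ((k : ℚ) + 1 / 2) l}

/-- Labels `τ_m` with `m` a positive half-odd integer. -/
def tauLabels : Set BlockLabel := Set.range tau

/-- Labels `-τ_m` with `m` a positive half-odd integer. -/
def negTauLabels : Set BlockLabel := Set.range negTau

/-- The direct sum of the graded symplectic spaces of the blocks `t 0, …, t (N - 1)`. -/
def sumSpace (K : Type*) [Field K] [CharZero K] {N : ℕ} (t : Fin N → BlockLabel) :
    GradedSymplecticSpace K (∀ j, (t j).Index → K) :=
  GradedSymplecticSpace.directSum fun j => (t j).space K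

/-- The direct sum of the endomorphisms of the blocks `t 0, …, t (N - 1)`. -/
noncomputable def sumEndo (K : Type*) [Field K] {N : ℕ} (t : Fin N → BlockLabel) :
    Module.End K (∀ j, (t j).Index → K) :=
  GradedSymplecticSpace.directSumEnd fun j => (t j).endo K

/-- The number of appearances of the block `b` in the list `t 0, …, t (N - 1)`. -/
noncomputable def multiplicity {N : ℕ} (t : Fin N → BlockLabel) (b : BlockLabel) : ℕ :=
  Nat.card {j : Fin N // t j = b}

end BlockLabel

/-- The integers, as degrees. -/
def integerDegrees : Set ℚ := {q | ∃ k : ℤ, q = k}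

/-- The half-odd integers `k + 1/2`, as degrees. -/
def halfOddDegrees : Set ℚ := {q | ∃ k : ℤ, q = k + 1 / 2}

/-! Existence is proved by splitting off one block at a time. Since `δ` lowers degrees, it is
nilpotent; let `n` be the largest exponent with `δ ^ n ≠ 0`. Write `B_k(x, y) = σ(δ^k x, y)`. As `δ`
is skew, `B_k` is symmetric for odd `k` and alternating for even `k`, and it pairs degree `a` only
with degree `k - a`. Nondegeneracy of `σ` gives homogeneous `x`, `y` of degrees `a` and `n - a` with
`B_n(x, y) ≠ 0`, and by symmetry one may take `2a ≥ n`.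

If `2a > n`, the string of `x` is isotropic for degree reasons and that of `y` becomes so after
adding a multiple of some `δ^j x`; if `2a = n` is even, both are isotropic because `B_n` is
alternating. Both cases give a block `δ_{a;n}` (`exists_delta_isEmbedding`). If `2a = n` is odd,
`B_n` is a nonzero symmetric form on `V_a`, so some `x` has `B_n(x, x) ≠ 0`, and its string is a
block `±τ_a` once `x` is rescaled: by any square root over the complex numbers, only up to sign over
the reals (`exists_delta_or_string`). The block carries a nondegenerate form, so its orthogonal
complement is a smaller space of the same kind, and `exists_isConj_sum` concludes by induction on
dimension.

For uniqueness, the ranks of `δ^k` on the graded components determine how many rows (Jordan strings)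
there are with given top degree and length (`sum_rowCount_eq`). In the allowed range of labels, a
row with top degree `s` and `l + 1` vectors, `l ≤ 2s`, comes only from `δ_{s;l}` if `l < 2s` or `l =
2s` is even, and only from `±τ_s` if `l = 2s` is odd. This gives all multiplicities except the split
between `τ` and `-τ`, which is settled over the reals by Sylvester's law of inertia for `(-1)^p
σ(δ^(2p+1) x, x)` on the kernel of `δ^(2p+2)` in degree `p + 1/2` (`form_nonpos`,
`multiplicity_tau_le`). -/

namespace GradedSymplecticSpace

/-! ### Homogeneous components, embeddings and orthogonal complements -/

section Basic

variable {K V W X : Type*} [Field K] [AddCommGroup V] [Module K V] [AddCommGroup W] [Module K W]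
  [AddCommGroup X] [Module K X]

theorem homogeneous_induction (S : GradedSymplecticSpace K V) {p : V → Prop} (x : V)
    (mem : ∀ i, ∀ x ∈ S.component i, p x) (zero : p 0) (add : ∀ x y, p x → p y → p (x + y)) :
    p x :=
  Submodule.iSup_induction S.component (motive := p)
    (by rw [S.isInternal.submodule_iSup_eq_top]; trivial) mem zero add

/-- The projection onto the component of degree `i`. -/
noncomputable def proj (S : GradedSymplecticSpace K V) (i : ℚ) : V →ₗ[K] V :=
  (S.component i).subtype ∘ₗ DirectSum.component K ℚ (fun i => S.component i) i ∘ₗ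
    (LinearEquiv.ofBijective (DirectSum.coeLinearMap S.component) S.isInternal).symm.toLinearMap

theorem proj_mem (S : GradedSymplecticSpace K V) (i : ℚ) (x : V) : S.proj i x ∈ S.component i :=
  Submodule.coe_mem _

theorem proj_of_mem (S : GradedSymplecticSpace K V) {i j : ℚ} {x : V} (hx : x ∈ S.component j) :
    S.proj i x = if j = i then x else 0 := by
  have h : (LinearEquiv.ofBijective (DirectSum.coeLinearMap S.component) S.isInternal).symm x =
      DirectSum.lof K ℚ (fun i => S.component i) j ⟨x, hx⟩ := by
    rw [LinearEquiv.symm_apply_eq]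
    exact (DirectSum.coeLinearMap_lof S.component j ⟨x, hx⟩).symm
  simp only [proj, LinearMap.comp_apply, LinearEquiv.coe_coe, h]
  split_ifs with hij
  · subst hij
    simp [DirectSum.component.lof_self]
  · rw [DirectSum.component.of]
    simp [hij]

theorem exists_sum_proj (S : GradedSymplecticSpace K V) (x : V) :
    ∃ s : Finset ℚ, ∑ i ∈ s, S.proj i x = x := by
  -- The stronger claim for all larger finite sets lets sums of vectors be handled by a union of
  -- supports.
  suffices h : ∃ s : Finset ℚ, ∀ t, s ⊆ t → ∑ i ∈ t, S.proj i x = x from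
    h.imp fun s hs => hs s subset_rfl
  induction x using S.homogeneous_induction with
  | mem i x hx =>
    refine ⟨{i}, fun t ht => ?_⟩
    simp only [S.proj_of_mem hx, Finset.sum_ite_eq]
    rw [if_pos (ht (by simp))]
  | zero => exact ⟨∅, fun t _ => by simp⟩
  | add x y hx hy =>
    obtain ⟨s, hs⟩ := hx
    obtain ⟨s', hs'⟩ := hy
    classical
    refine ⟨s ∪ s', fun t ht => ?_⟩
    simp only [map_add, Finset.sum_add_distrib, hs t (Finset.union_subset_left ht),
      hs' t (Finset.union_subset_right ht)]

theorem form_proj (S : GradedSymplecticSpace K V) {i k : ℚ} (hik : k + i = 0) {y : V}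
    (hy : y ∈ S.component k) (x : V) : S.form y (S.proj i x) = S.form y x := by
  induction x using S.homogeneous_induction with
  | mem j x hx =>
    rw [S.proj_of_mem hx]
    split_ifs with h
    · rfl
    · rw [map_zero, S.form_eq_zero k j (fun h' => h (by linarith)) y hy x hx]
  | zero => simp
  | add x y hx hy => simp [hx, hy]

theorem form_apply_left (S : GradedSymplecticSpace K V) {δ : Module.End K V}
    (hδ : δ ∈ S.spDegreeNegOne) (x y : V) : S.form (δ x) y = - S.form x (δ y) := by
  have := hδ.1 x y
  simpa using this

theorem form_pow_apply_left (S : GradedSymplecticSpace K V) {δ : Module.End K V}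
    (hδ : δ ∈ S.spDegreeNegOne) (n : ℕ) (x y : V) :
    S.form ((δ ^ n) x) y = (-1) ^ n * S.form x ((δ ^ n) y) := by
  induction n generalizing y with
  | zero => simp
  | succ n ih =>
    rw [pow_succ', Module.End.mul_apply, S.form_apply_left hδ, ih, ← Module.End.mul_apply,
      ← pow_succ, ← pow_succ', pow_succ]
    ring

theorem pow_apply_mem (S : GradedSymplecticSpace K V) {δ : Module.End K V}
    (hδ : δ ∈ S.spDegreeNegOne) (n : ℕ) {i : ℚ} {x : V} (hx : x ∈ S.component i) :
    (δ ^ n) x ∈ S.component (i - n) := by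
  induction n with
  | zero => simpa using hx
  | succ n ih =>
    rw [pow_succ', Module.End.mul_apply]
    have := hδ.2 _ _ ih
    rwa [sub_sub, ← Nat.cast_succ] at this

theorem form_swap (S : GradedSymplecticSpace K V) (x y : V) : S.form x y = - S.form y x :=
  (S.isAlt.neg y x).symm

/-- An injective linear map that preserves the symplectic forms and intertwines the
endomorphisms, and that maps every graded component to the component of the same degree. -/
structure IsEmbedding (T : GradedSymplecticSpace K W) (ε : Module.End K W)
    (S : GradedSymplecticSpace K V) (δ : Module.End K V) (φ : W →ₗ[K] V) : Prop where
  form_map : ∀ x y, S.form (φ x) (φ y) = T.form x y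
  map_mem : ∀ i, ∀ x ∈ T.component i, φ x ∈ S.component i
  comm : ∀ x, φ (ε x) = δ (φ x)

namespace IsEmbedding

variable {T : GradedSymplecticSpace K W} {ε : Module.End K W} {S : GradedSymplecticSpace K V}
  {δ : Module.End K V} {φ : W →ₗ[K] V}

/-- A vector killed by a form-preserving map is orthogonal to everything, so injectivity follows
from nondegeneracy and need not be a field of `IsEmbedding`. -/
theorem injective (h : IsEmbedding T ε S δ φ) : Function.Injective φ := by
  rw [injective_iff_map_eq_zero]
  intro x hx
  refine T.nondegenerate.1 x fun y => ?_
  rw [← h.form_map, hx, map_zero, LinearMap.zero_apply]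

theorem proj_map (h : IsEmbedding T ε S δ φ) (i : ℚ) (x : W) :
    S.proj i (φ x) = φ (T.proj i x) := by
  induction x using T.homogeneous_induction with
  | mem j x hx =>
    rw [T.proj_of_mem hx, S.proj_of_mem (h.map_mem j x hx)]
    split_ifs <;> simp
  | zero => simp
  | add x y hx hy => simp [hx, hy]

theorem pow_comm (h : IsEmbedding T ε S δ φ) (n : ℕ) (x : W) :
    φ ((ε ^ n) x) = (δ ^ n) (φ x) := by
  induction n generalizing x with
  | zero => simp
  | succ n ih => rw [pow_succ, Module.End.mul_apply, ih, h.comm, pow_succ, Module.End.mul_apply]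

/-- Inclusion of components upgrades to equality: `φ` commutes with the projections, so a preimage
of a homogeneous vector can be replaced by its component of that degree. -/
theorem isConj (h : IsEmbedding T ε S δ φ) (hs : Function.Surjective φ) : T.IsConj ε S δ := by
  refine ⟨LinearEquiv.ofBijective φ ⟨h.injective, hs⟩, h.form_map, fun i => ?_, h.comm⟩
  refine le_antisymm ?_ fun y hy => ?_
  · rintro _ ⟨x, hx, rfl⟩
    exact h.map_mem i x hx
  · obtain ⟨x, rfl⟩ := hs y
    refine ⟨T.proj i x, T.proj_mem i x, ?_⟩
    have := h.proj_map i x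
    rw [S.proj_of_mem hy, if_pos rfl] at this
    exact this.symm

end IsEmbedding

theorem IsConj.exists_isEmbedding {T : GradedSymplecticSpace K W} {ε : Module.End K W}
    {S : GradedSymplecticSpace K V} {δ : Module.End K V} (h : T.IsConj ε S δ) :
    ∃ φ : W →ₗ[K] V, IsEmbedding T ε S δ φ ∧ Function.Surjective φ := by
  obtain ⟨φ, h1, h2, h3⟩ := h
  exact ⟨φ, ⟨h1, fun i x hx => by rw [← h2 i]; exact ⟨x, hx, rfl⟩, h3⟩, φ.surjective⟩

theorem IsConj.symm {T : GradedSymplecticSpace K W} {ε : Module.End K W}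
    {S : GradedSymplecticSpace K V} {δ : Module.End K V} (h : T.IsConj ε S δ) :
    S.IsConj δ T ε := by
  obtain ⟨φ, h1, h2, h3⟩ := h
  refine ⟨φ.symm, fun x y => by rw [← h1]; simp, fun i => ?_, fun x => ?_⟩
  · rw [← h2 i, ← Submodule.map_comp]
    simp
  · rw [LinearEquiv.symm_apply_eq, h3, LinearEquiv.apply_symm_apply]

theorem IsConj.trans {T : GradedSymplecticSpace K W} {ε : Module.End K W}
    {S : GradedSymplecticSpace K V} {δ : Module.End K V} {U : GradedSymplecticSpace K X}
    {η : Module.End K X} (h : T.IsConj ε S δ) (h' : S.IsConj δ U η) : T.IsConj ε U η := by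
  obtain ⟨φ, h1, h2, h3⟩ := h
  obtain ⟨ψ, h1', h2', h3'⟩ := h'
  refine ⟨φ.trans ψ, fun x y => by simp [h1, h1'], fun i => ?_, fun x => by simp [h3, h3']⟩
  rw [← h2', ← h2, ← Submodule.map_comp]
  rfl

/-- The graded symplectic space structure on a graded subspace on which the form is
nondegenerate. -/
def restrict (S : GradedSymplecticSpace K V) (P : Submodule K V)
    (hP : ∀ i, ∀ x ∈ P, S.proj i x ∈ P)
    (hnd : ∀ x ∈ P, (∀ y ∈ P, S.form x y = 0) → x = 0) : GradedSymplecticSpace K P where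
  form := S.form.domRestrict₁₂ P P
  isAlt x := S.isAlt x
  nondegenerate :=
    ⟨fun x hx => Subtype.ext (hnd x x.2 fun y hy => hx ⟨y, hy⟩),
      fun x hx => Subtype.ext (hnd x x.2 fun y hy => by
        rw [form_swap, neg_eq_zero]; exact hx ⟨y, hy⟩)⟩
  component i := (S.component i).comap P.subtype
  isInternal := by
    rw [DirectSum.isInternal_submodule_iff_iSupIndep_and_iSup_eq_top]
    constructor
    · rw [iSupIndep_def]
      intro i
      rw [Submodule.disjoint_def]
      intro x hx hx'
      have hle : (⨆ j, ⨆ (_ : j ≠ i), (S.component j).comap P.subtype) ≤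
          LinearMap.ker (S.proj i ∘ₗ P.subtype) := by
        refine iSup₂_le fun j hj y hy => ?_
        rw [LinearMap.mem_ker, LinearMap.comp_apply, S.proj_of_mem hy, if_neg hj]
      have h := hle hx'
      rw [LinearMap.mem_ker, LinearMap.comp_apply, S.proj_of_mem hx, if_pos rfl] at h
      exact Subtype.ext h
    · rw [eq_top_iff]
      intro x _
      obtain ⟨s, hs⟩ := S.exists_sum_proj x
      have : x = ∑ i ∈ s, (⟨S.proj i x, hP i x x.2⟩ : P) := by
        apply Subtype.ext
        rw [AddSubmonoidClass.coe_finsetSum]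
        exact hs.symm
      rw [this]
      exact Submodule.sum_mem _ fun i _ => Submodule.mem_iSup_of_mem i (S.proj_mem i x)
  form_eq_zero i j hij x hx y hy := S.form_eq_zero i j hij x hx y hy

/-- The skew-orthogonal complement of the range of a linear map. -/
def rangeOrtho (S : GradedSymplecticSpace K V) (φ : W →ₗ[K] V) : Submodule K V :=
  LinearMap.ker (S.form ∘ₗ φ).flip

theorem mem_rangeOrtho {S : GradedSymplecticSpace K V} {φ : W →ₗ[K] V} {x : V} :
    x ∈ S.rangeOrtho φ ↔ ∀ w, S.form (φ w) x = 0 := by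
  rw [rangeOrtho, LinearMap.mem_ker, LinearMap.ext_iff]
  rfl

namespace IsEmbedding

variable {T : GradedSymplecticSpace K W} {ε : Module.End K W} {S : GradedSymplecticSpace K V}
  {δ : Module.End K V} {φ : W →ₗ[K] V}

/-- The functional `σ(φ ·, x)` on the finite-dimensional `W` is represented by a vector `w`, because
the form of `T` is nondegenerate. Hence `V` is the sum of the range and its orthogonal complement.
-/
theorem exists_sub_mem_rangeOrtho [FiniteDimensional K W] (h : IsEmbedding T ε S δ φ) (x : V) :
    ∃ w, x - φ w ∈ S.rangeOrtho φ := by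
  have hinj : Function.Injective (T.form.flip : W →ₗ[K] Module.Dual K W) := by
    rw [injective_iff_map_eq_zero]
    intro w hw
    exact T.nondegenerate.2 w fun y => LinearMap.congr_fun hw y
  have hsurj := (LinearMap.injective_iff_surjective_of_finrank_eq_finrank
    (Subspace.dual_finrank_eq (K := K) (V := W)).symm).1 hinj
  obtain ⟨w, hw⟩ := hsurj ((S.form ∘ₗ φ).flip x)
  refine ⟨w, mem_rangeOrtho.2 fun w' => ?_⟩
  have := LinearMap.congr_fun hw w'
  simp only [LinearMap.flip_apply, LinearMap.comp_apply] at this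
  rw [map_sub, h.form_map, this, sub_self]

theorem proj_mem_rangeOrtho (h : IsEmbedding T ε S δ φ) (i : ℚ) (x : V)
    (hx : x ∈ S.rangeOrtho φ) : S.proj i x ∈ S.rangeOrtho φ := by
  rw [mem_rangeOrtho] at hx ⊢
  intro w
  induction w using T.homogeneous_induction with
  | mem k w hw =>
    by_cases hk : k + i = 0
    · rw [S.form_proj hk (h.map_mem k w hw), hx]
    · exact S.form_eq_zero k i hk _ (h.map_mem k w hw) _ (S.proj_mem i x)
  | zero => simp
  | add x y hx hy => simp [hx, hy]

/-- A vector orthogonal to both the range and its complement is orthogonal to their sum, which is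
all of `V`. -/
theorem eq_zero_of_mem_rangeOrtho [FiniteDimensional K W] (h : IsEmbedding T ε S δ φ) (x : V)
    (hx : x ∈ S.rangeOrtho φ) (hx' : ∀ y ∈ S.rangeOrtho φ, S.form x y = 0) : x = 0 := by
  refine S.nondegenerate.1 x fun y => ?_
  obtain ⟨w, hw⟩ := h.exists_sub_mem_rangeOrtho y
  have h1 := hx' _ hw
  rwa [map_sub, S.form_swap x (φ w), mem_rangeOrtho.1 hx w, neg_zero, sub_zero] at h1

theorem apply_mem_rangeOrtho (h : IsEmbedding T ε S δ φ) (hδ : δ ∈ S.spDegreeNegOne) (x : V)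
    (hx : x ∈ S.rangeOrtho φ) : δ x ∈ S.rangeOrtho φ := by
  rw [mem_rangeOrtho] at hx ⊢
  intro w
  have := S.form_apply_left hδ (φ w) x
  rw [← h.comm, hx] at this
  simpa using this.symm

end IsEmbedding

end Basic

/-! ### Decomposition by splitting off one block at a time -/

section Blocks

universe u v

variable {K : Type u} [Field K] [CharZero K]

/-- If a block labelled by `L` embeds in every nonzero space with degrees in `D`, then every
space with degrees in `D` is a direct sum of such blocks. -/
theorem exists_isConj_sum {L : Set BlockLabel} {D : Set ℚ}
    (H : ∀ (V : Type v) [AddCommGroup V] [Module K V] [FiniteDimensional K V] [Nontrivial V]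
      (S : GradedSymplecticSpace K V), S.DegreesIn D → ∀ δ ∈ S.spDegreeNegOne,
      ∃ b ∈ L, ∃ φ, IsEmbedding (b.space K) (b.endo K) S δ φ)
    (V : Type v) [AddCommGroup V] [Module K V] [FiniteDimensional K V]
    (S : GradedSymplecticSpace K V) (hD : S.DegreesIn D) (δ : Module.End K V)
    (hδ : δ ∈ S.spDegreeNegOne) :
    ∃ (N : ℕ) (t : Fin N → BlockLabel), (∀ j, t j ∈ L) ∧
      S.IsConj δ (BlockLabel.sumSpace K t) (BlockLabel.sumEndo K t) := by
  induction hn : Module.finrank K V using Nat.strong_induction_on generalizing V with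
  | _ n ih =>
  rcases subsingleton_or_nontrivial V with hV | hV
  · refine ⟨0, Fin.elim0, fun j => j.elim0, IsConj.symm ?_⟩
    refine IsEmbedding.isConj (φ := 0) ⟨fun x y => ?_, fun i x _ => ?_, fun x => ?_⟩
      fun x => ⟨0, Subsingleton.elim _ _⟩
    · rw [Subsingleton.elim x 0]; simp
    · simp
    · exact Subsingleton.elim _ _
  obtain ⟨b, hb, φ, hφ⟩ := H V S hD δ hδ
  let P := S.rangeOrtho φ
  let S' := S.restrict P hφ.proj_mem_rangeOrtho hφ.eq_zero_of_mem_rangeOrtho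
  let δ' : Module.End K P := δ.restrict (hφ.apply_mem_rangeOrtho hδ)
  -- If the complement were everything, the image of a basis vector of the block would lie in the
  -- radical of `σ`.
  have hlt : Module.finrank K P < n := by
    rw [← hn]
    refine Submodule.finrank_lt fun htop => ?_
    obtain ⟨a⟩ : Nonempty b.Index := by
      rcases b with ⟨s, l⟩ | p | p
      · exact ⟨Sum.inl 0⟩
      · exact ⟨(0 : Fin (2 * p + 2))⟩
      · exact ⟨(0 : Fin (2 * p + 2))⟩
    have h0 : φ (Pi.single a 1) = 0 := by
      refine S.nondegenerate.1 _ fun y => ?_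
      have : y ∈ P := by rw [htop]; trivial
      exact mem_rangeOrtho.1 this _
    have := hφ.injective (h0.trans φ.map_zero.symm)
    simpa using congr_fun this a
  obtain ⟨N, t, ht, hc⟩ := ih _ hlt P S'
    (fun i hi => by
      change (S.component i).comap P.subtype = ⊥
      rw [hD i hi, Submodule.comap_bot, Submodule.ker_subtype])
    δ' ⟨fun x y => hδ.1 (x : V) (y : V), fun i x hx => hδ.2 i x hx⟩ rfl
  obtain ⟨ψ, hψ, hψs⟩ := hc.symm.exists_isEmbedding
  refine ⟨N + 1, Fin.cons b t, fun j => ?_, IsConj.symm ?_⟩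
  · refine Fin.cases hb ht j
  let hd : (∀ j, ((Fin.cons b t : Fin (N + 1) → BlockLabel) j).Index → K) →ₗ[K] (b.Index → K) :=
    LinearMap.proj (φ := fun j => ((Fin.cons b t : Fin (N + 1) → BlockLabel) j).Index → K) 0
  let tl : (∀ j, ((Fin.cons b t : Fin (N + 1) → BlockLabel) j).Index → K) →ₗ[K]
      (∀ j, (t j).Index → K) := LinearMap.pi fun j : Fin N =>
    LinearMap.proj (φ := fun j => ((Fin.cons b t : Fin (N + 1) → BlockLabel) j).Index → K) j.succ
  have hform : ∀ x y, (BlockLabel.sumSpace K (Fin.cons b t : Fin (N + 1) → BlockLabel)).form x y =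
      (b.space K).form (hd x) (hd y) + (BlockLabel.sumSpace K t).form (tl x) (tl y) :=
    fun x y => Fin.sum_univ_succ _
  have hhd : ∀ x, hd (BlockLabel.sumEndo K (Fin.cons b t : Fin (N + 1) → BlockLabel) x) =
    b.endo K (hd x) := fun x => rfl
  have htl : ∀ x, tl (BlockLabel.sumEndo K (Fin.cons b t : Fin (N + 1) → BlockLabel) x) =
    BlockLabel.sumEndo K t (tl x) := fun x => rfl
  have hΦ : ∀ w, (φ ∘ₗ hd + P.subtype ∘ₗ ψ ∘ₗ tl) w = φ (hd w) + ψ (tl w) := fun w => rfl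
  have hψ1 : ∀ x y, S.form (ψ x) (ψ y) = (BlockLabel.sumSpace K t).form x y := hψ.form_map
  have hψ2 : ∀ x, (ψ (BlockLabel.sumEndo K t x) : V) = δ (ψ x) :=
    fun x => congr_arg P.subtype (hψ.comm x)
  have h1 : ∀ x y, S.form (φ x) (ψ y) = 0 := fun x y => mem_rangeOrtho.1 (Subtype.prop _) _
  have h2 : ∀ x y, S.form (ψ y) (φ x) = 0 := fun x y => by rw [form_swap, h1, neg_zero]
  -- The first summand goes to the block found in `V`, the others to its orthogonal complement, so
  -- the cross terms of the form vanish.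
  refine IsEmbedding.isConj (φ := φ ∘ₗ hd + P.subtype ∘ₗ ψ ∘ₗ tl)
    ⟨fun x y => ?_, fun i x hx => ?_, fun x => ?_⟩ fun x => ?_
  · rw [hΦ, hΦ, hform, map_add, map_add, LinearMap.add_apply, LinearMap.add_apply, h1, h2, hψ1,
      hφ.form_map, add_zero, zero_add]
  · rw [hΦ]
    refine Submodule.add_mem _ (hφ.map_mem i _ (hx 0 trivial)) ?_
    exact hψ.map_mem i _ fun j _ => hx j.succ trivial
  · rw [hΦ, hΦ, map_add, ← hφ.comm, hhd, htl, hψ2]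
  · obtain ⟨w, hw⟩ := hφ.exists_sub_mem_rangeOrtho x
    obtain ⟨u, hu⟩ := hψs ⟨_, hw⟩
    refine ⟨(Fin.cons w u : ∀ j, ((Fin.cons b t : Fin (N + 1) → BlockLabel) j).Index → K), ?_⟩
    have e1 : hd (Fin.cons w u : ∀ j, ((Fin.cons b t : Fin (N + 1) → BlockLabel) j).Index → K) = w :=
      rfl
    have e2 : tl (Fin.cons w u : ∀ j, ((Fin.cons b t : Fin (N + 1) → BlockLabel) j).Index → K) = u :=
      rfl
    rw [hΦ, e1, e2, hu]
    simp

end Blocks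

end GradedSymplecticSpace

namespace GradedSymplecticSpace

/-! ### A block inside every nonzero space -/

section Existence

variable {K V : Type*} [Field K] [AddCommGroup V] [Module K V]
  {S : GradedSymplecticSpace K V} {δ : Module.End K V}

/-- This reduces the search for a block to exhibiting vectors with the prescribed degrees, pairings
and images under `δ`: the form and the intertwining relation are checked on a basis. -/
theorem isEmbedding_constr [CharZero K] (b : BlockLabel) (v : b.Index → V)
    (hdeg : ∀ a, v a ∈ S.component (b.deg a))
    (hform : ∀ a c, S.form (v a) (v c) = if b.inv a = c then (b.sgn a : K) else 0)
    (hnext : ∀ a, δ (v a) = (b.next a).elim 0 fun c => (b.coeff : K) • v c) :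
    IsEmbedding (b.space K) (b.endo K) S δ ((Pi.basisFun K b.Index).constr K v) := by
  set φ := (Pi.basisFun K b.Index).constr K v with hφ
  have hv : ∀ a, φ (Pi.single a 1) = v a := fun a => by
    rw [← Pi.basisFun_apply, hφ, Module.Basis.constr_basis]
  refine ⟨fun x y => ?_, fun i x hx => ?_, fun x => ?_⟩
  · have key : S.form.compl₁₂ φ φ = (b.space K).form := by
      refine (Pi.basisFun K b.Index).ext fun a => (Pi.basisFun K b.Index).ext fun c => ?_
      rw [LinearMap.compl₁₂_apply, Pi.basisFun_apply, Pi.basisFun_apply, hv, hv, hform]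
      refine Eq.trans ?_ (ofBasis_form (K := K) b.deg b.inv b.sgn _ _ _ _ a c 1 1).symm
      simp
    exact LinearMap.congr_fun (LinearMap.congr_fun key x) y
  · rw [hφ, Module.Basis.constr_apply_fintype]
    refine Submodule.sum_mem _ fun a _ => ?_
    by_cases ha : x a = 0
    · simp [ha]
    · rw [← hx a ha]
      exact Submodule.smul_mem _ _ (hdeg a)
  · have key : φ ∘ₗ b.endo K = δ ∘ₗ φ := by
      refine (Pi.basisFun K b.Index).ext fun a => ?_
      rw [LinearMap.comp_apply, LinearMap.comp_apply, Pi.basisFun_apply, hv, hnext,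
        BlockLabel.endo, ofBasisEnd_single]
      rcases b.next a with _ | c
      · simp
      · have : (Pi.single c (b.coeff : K) : b.Index → K) = (b.coeff : K) • Pi.single c 1 := by
          rw [← Pi.single_smul, smul_eq_mul, mul_one]
        simp only [Option.elim, this, map_smul, hv]
    exact LinearMap.congr_fun key x

/-- Only finitely many components are nonzero, so repeatedly lowering the degree of a homogeneous
vector reaches a zero component. -/
theorem isNilpotent_of_mem_spDegreeNegOne [FiniteDimensional K V] (hδ : δ ∈ S.spDegreeNegOne) :
    IsNilpotent δ := by
  have hfin := WellFoundedGT.finite_ne_bot_of_iSupIndep S.isInternal.submodule_iSupIndep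
  rw [Module.End.isNilpotent_iff_of_finite]
  intro x
  induction x using S.homogeneous_induction with
  | mem i x hx =>
    have hinj : Function.Injective fun k : ℕ => i - (k : ℚ) := fun k l h => by simpa using h
    obtain ⟨k, hk⟩ : ∃ k : ℕ, S.component (i - k) = ⊥ := by
      by_contra! h
      exact Set.infinite_of_injective_forall_mem hinj (fun k => h k) hfin
    refine ⟨k, ?_⟩
    have := S.pow_apply_mem hδ k hx
    rwa [hk, Submodule.mem_bot] at this
  | zero => exact ⟨0, by simp⟩
  | add x y hx hy =>
    obtain ⟨k, hk⟩ := hx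
    obtain ⟨l, hl⟩ := hy
    refine ⟨k + l, ?_⟩
    have h1 : (δ ^ (k + l)) x = 0 := by
      rw [add_comm, pow_add, Module.End.mul_apply, hk, map_zero]
    have h2 : (δ ^ (k + l)) y = 0 := by rw [pow_add, Module.End.mul_apply, hl, map_zero]
    rw [map_add, h1, h2, add_zero]

theorem exists_pow_ne_zero [FiniteDimensional K V] [Nontrivial V] (hδ : δ ∈ S.spDegreeNegOne) :
    ∃ n, δ ^ n ≠ 0 ∧ δ ^ (n + 1) = 0 := by
  classical
  have h := isNilpotent_of_mem_spDegreeNegOne hδ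
  have hpos : Nat.find h ≠ 0 := fun h0 => by
    have := Nat.find_spec h
    rw [h0, pow_zero] at this
    exact one_ne_zero this
  obtain ⟨n, hn⟩ := Nat.exists_eq_succ_of_ne_zero hpos
  refine ⟨n, Nat.find_min h (by omega), ?_⟩
  have := Nat.find_spec h
  rwa [hn] at this

theorem exists_form_pow_ne_zero (hδ : δ ∈ S.spDegreeNegOne) {n : ℕ} (hn : δ ^ n ≠ 0) :
    ∃ a, ∃ x ∈ S.component a, ∃ y ∈ S.component (n - a), S.form ((δ ^ n) x) y ≠ 0 := by
  by_contra! h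
  refine hn (LinearMap.ext fun x => S.nondegenerate.1 _ fun y => ?_)
  induction x using S.homogeneous_induction with
  | mem i x hx =>
    induction y using S.homogeneous_induction with
    | mem j y hy =>
      by_cases hj : j = n - i
      · subst hj; exact h i x hx y hy
      · exact S.form_eq_zero _ _ (fun h' => hj (by linarith)) _ (S.pow_apply_mem hδ n hx) _ hy
    | zero => simp
    | add x y hx hy => simp [hx, hy]
  | zero => simp
  | add x y hx hy => simp [hx, hy]

/-- All pairings inside and between strings thereby reduce to the forms `B_k(x, y) = σ(δ^k x, y)`.
-/
theorem form_pow_pow (hδ : δ ∈ S.spDegreeNegOne) (j k : ℕ) (x y : V) :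
    S.form ((δ ^ j) x) ((δ ^ k) y) = (-1) ^ k * S.form ((δ ^ (j + k)) x) y := by
  rw [add_comm j k, pow_add, Module.End.mul_apply, form_pow_apply_left S hδ k, ← mul_assoc,
    ← mul_pow]
  simp

/-- Moving `δ^k` across the form costs `(-1)^k`, and exchanging the arguments costs another `-1`.
Thus `B_k` is alternating for even `k` and symmetric for odd `k`. -/
theorem form_pow_self_of_even [CharZero K] (hδ : δ ∈ S.spDegreeNegOne) {k : ℕ} (hk : Even k)
    (x : V) : S.form ((δ ^ k) x) x = 0 := by
  have h := form_pow_apply_left S hδ k x x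
  rw [hk.neg_one_pow, one_mul, form_swap S x] at h
  exact CharZero.eq_neg_self_iff.1 h

theorem form_pow_swap_of_odd (hδ : δ ∈ S.spDegreeNegOne) {k : ℕ} (hk : Odd k)
    (x y : V) : S.form ((δ ^ k) x) y = S.form ((δ ^ k) y) x := by
  rw [form_pow_apply_left S hδ k x y, hk.neg_one_pow, form_swap S x]
  ring

theorem form_pow_eq_zero (hδ : δ ∈ S.spDegreeNegOne) {k : ℕ} {a b : ℚ} {x y : V}
    (hx : x ∈ S.component a) (hy : y ∈ S.component b) (h : (k : ℚ) ≠ a + b) :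
    S.form ((δ ^ k) x) y = 0 :=
  S.form_eq_zero _ _ (fun h' => h (by linarith)) _ (S.pow_apply_mem hδ k hx) _ hy

theorem pow_eq_zero_of_lt {n k : ℕ} (hn : δ ^ (n + 1) = 0) (hk : n < k) : δ ^ k = 0 :=
  pow_eq_zero_of_le hk hn

theorem exists_delta_isEmbedding [CharZero K] (hδ : δ ∈ S.spDegreeNegOne) {n : ℕ} {a : ℚ}
    {x y : V} (hx : x ∈ S.component a) (hy : y ∈ S.component (n - a)) (hn : δ ^ (n + 1) = 0)
    (hB : S.form ((δ ^ n) x) y ≠ 0) (hxx : ∀ k, S.form ((δ ^ k) x) x = 0)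
    (hyy : ∀ k, S.form ((δ ^ k) y) y = 0) :
    ∃ φ, IsEmbedding ((BlockLabel.delta a n).space K) ((BlockLabel.delta a n).endo K) S δ φ := by
  -- The scale is chosen so that `σ(x, c δ^n y) = 1`: moving `δ^n` to the other argument produces
  -- the factor `(-1)^n`.
  obtain ⟨c, hc⟩ : ∃ c : K, c * S.form ((δ ^ n) x) y = (-1) ^ n :=
    ⟨(-1) ^ n / S.form ((δ ^ n) x) y, div_mul_cancel₀ _ hB⟩
  have h12 : ∀ j k : Fin (n + 1), S.form ((δ ^ (j : ℕ)) x) (c • (δ ^ (k : ℕ)) y) =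
      if j.rev = k then (-1) ^ (j : ℕ) else 0 := by
    intro j k
    rw [map_smul, form_pow_pow hδ, smul_eq_mul]
    split_ifs with h
    · have hk : (k : ℕ) + j = n := by rw [← h, Fin.val_rev]; omega
      rw [add_comm (j : ℕ), hk, mul_left_comm, hc]
      have h1 : (-1 : K) ^ n = (-1) ^ (k : ℕ) * (-1) ^ (j : ℕ) := by rw [← pow_add, hk]
      rw [h1, ← mul_assoc, ← mul_pow]
      simp
    · rw [form_pow_eq_zero hδ hx hy, mul_zero, mul_zero]
      intro h'
      apply h
      have : (j : ℕ) + (k : ℕ) = n := by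
        have : (((j : ℕ) + (k : ℕ) : ℕ) : ℚ) = n := by rw [h']; ring
        exact_mod_cast this
      rw [Fin.ext_iff, Fin.val_rev]
      omega
  refine ⟨_, isEmbedding_constr (BlockLabel.delta a n)
    (fun i => Sum.elim (fun j : Fin (n + 1) => (δ ^ (j : ℕ)) x)
      (fun j : Fin (n + 1) => c • (δ ^ (j : ℕ)) y) i) ?_ ?_ ?_⟩
  · rintro (j | j)
    · exact S.pow_apply_mem hδ _ hx
    · exact Submodule.smul_mem _ _ (S.pow_apply_mem hδ _ hy)
  · rintro (j | j) (k | k)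
    · simp [form_pow_pow hδ, hxx, BlockLabel.inv]
    · simp only [Sum.elim_inl, Sum.elim_inr, h12, BlockLabel.inv, BlockLabel.sgn, Sum.inr.injEq]
      split_ifs <;> simp
    · simp only [Sum.elim_inl, Sum.elim_inr, BlockLabel.inv, BlockLabel.sgn, Sum.inl.injEq]
      rw [form_swap, h12]
      have : k.rev = j ↔ j.rev = k := by
        constructor <;> (intro h; rw [← h, Fin.rev_rev])
      simp only [this]
      split_ifs with h
      · rw [← h]; push_cast; rfl
      · simp
    · simp [form_pow_pow hδ, hyy, BlockLabel.inv]
  · have key : ∀ (z : V) (j : Fin (n + 1)), δ ((δ ^ (j : ℕ)) z) =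
        (BlockLabel.finNext j).elim 0 fun k => (δ ^ (k : ℕ)) z := by
      intro z j
      rw [← Module.End.mul_apply, ← pow_succ']
      unfold BlockLabel.finNext
      split_ifs with h
      · rfl
      · rw [pow_eq_zero_of_lt hn (by omega)]; rfl
    rintro (j | j)
    · simp only [BlockLabel.next, Sum.elim_inl, key]
      rcases BlockLabel.finNext j with _ | k <;> simp [BlockLabel.coeff]
    · simp only [BlockLabel.next, Sum.elim_inr, map_smul, key]
      rcases BlockLabel.finNext j with _ | k <;> simp [BlockLabel.coeff]

/-- A vector of degree `(n - a)` that pairs nontrivially with `δ ^ n x` can be chosen such that it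
spans, together with its images, an isotropic subspace. -/
theorem exists_form_pow_self_eq_zero [CharZero K] (hδ : δ ∈ S.spDegreeNegOne) {n : ℕ} {a : ℚ}
    {x y : V} (hx : x ∈ S.component a) (hy : y ∈ S.component (n - a)) (hn : δ ^ (n + 1) = 0)
    (hB : S.form ((δ ^ n) x) y ≠ 0) (ha : (n : ℚ) < 2 * a) :
    ∃ y ∈ S.component (n - a), S.form ((δ ^ n) x) y ≠ 0 ∧ ∀ k, S.form ((δ ^ k) y) y = 0 := by
  by_cases h : ∃ k, S.form ((δ ^ k) y) y ≠ 0
  swap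
  · push Not at h
    exact ⟨y, hy, hB, h⟩
  obtain ⟨k, hk⟩ := h
  have hkdeg : (k : ℚ) = n - a + (n - a) := by
    by_contra h
    exact hk (form_pow_eq_zero hδ hy hy h)
  -- The only `k` that can obstruct isotropy is `2(n - a)`; it is odd because `B_k` is alternating
  -- for even `k`, and less than `n` because `n < 2a`.
  have hkodd : Odd k := by
    by_contra h
    exact hk (form_pow_self_of_even hδ (Nat.not_odd_iff_even.1 h) y)
  have hkn : k < n := by
    have : (k : ℚ) < n := by rw [hkdeg]; linarith
    exact_mod_cast this
  have hu : (δ ^ (n - k)) x ∈ S.component (n - a) := by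
    have := S.pow_apply_mem hδ (n - k) hx
    rw [Nat.cast_sub hkn.le, hkdeg] at this
    convert this using 2
    ring
  have hku : (δ ^ k) ((δ ^ (n - k)) x) = (δ ^ n) x := by
    rw [← Module.End.mul_apply, ← pow_add, Nat.add_sub_cancel' hkn.le]
  have hxu : S.form ((δ ^ n) x) ((δ ^ (n - k)) x) = 0 := by
    rw [form_pow_pow hδ, pow_eq_zero_of_lt hn (by omega)]
    simp
  -- With `u = δ^(n-k) x` one has `δ^k u = δ^n x` and `B_n(x, u) = 0`, so `B_k(y + c u, y + c u) =
  -- B_k(y, y) + 2 c B_n(x, y)` is affine in `c`; this `c` is its root.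
  set c : K := - S.form ((δ ^ k) y) y / (2 * S.form ((δ ^ n) x) y) with hc
  have hy' : y + c • (δ ^ (n - k)) x ∈ S.component (n - a) :=
    Submodule.add_mem _ hy (Submodule.smul_mem _ _ hu)
  refine ⟨_, hy', ?_, fun j => ?_⟩
  · rw [map_add, map_smul, hxu, smul_zero, add_zero]
    exact hB
  · by_cases hj : j = k
    · subst hj
      simp only [map_add, map_smul, LinearMap.add_apply, LinearMap.smul_apply, smul_eq_mul, hku,
        hxu]
      rw [form_pow_swap_of_odd hδ hkodd y ((δ ^ (n - j)) x), hku, hc]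
      field_simp
      ring
    · refine form_pow_eq_zero hδ hy' hy' fun h => hj ?_
      rw [← hkdeg] at h
      exact_mod_cast h

/-- A nonzero graded symplectic space with a degree `-1` element of the symplectic algebra
contains a block `δ_{s;l}`, or else a vector `x` of degree `n / 2`, with `n` odd, that generates
a nondegenerate string. -/
theorem exists_delta_or_string [CharZero K] [FiniteDimensional K V] [Nontrivial V]
    (hδ : δ ∈ S.spDegreeNegOne) :
    (∃ (a : ℚ) (n : ℕ), S.component a ≠ ⊥ ∧ ((n : ℚ) < 2 * a ∨ (n : ℚ) = 2 * a ∧ Even n) ∧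
      ∃ φ, IsEmbedding ((BlockLabel.delta a n).space K) ((BlockLabel.delta a n).endo K) S δ φ) ∨
    ∃ p : ℕ, ∃ x ∈ S.component ((p : ℚ) + 1 / 2), δ ^ (2 * p + 2) = 0 ∧
      S.form ((δ ^ (2 * p + 1)) x) x ≠ 0 := by
  obtain ⟨n, hn0, hn⟩ := exists_pow_ne_zero hδ
  obtain ⟨a, x, hx, y, hy, hB, ha⟩ : ∃ a, ∃ x ∈ S.component a, ∃ y ∈ S.component (n - a),
      S.form ((δ ^ n) x) y ≠ 0 ∧ (n : ℚ) ≤ 2 * a := by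
    obtain ⟨a, x, hx, y, hy, hB⟩ := exists_form_pow_ne_zero hδ hn0
    by_cases ha : (n : ℚ) ≤ 2 * a
    · exact ⟨a, x, hx, y, hy, hB, ha⟩
    -- Exchanging `x` and `y` changes `B_n` only by a sign and replaces `a` by `n - a`.
    · refine ⟨n - a, y, hy, x, by rwa [sub_sub_cancel], ?_, by linarith⟩
      rw [form_pow_apply_left S hδ, form_swap]
      simpa using hB
  have hbot : S.component a ≠ ⊥ := fun h => by
    rw [h, Submodule.mem_bot] at hx
    simp [hx] at hB
  rcases ha.lt_or_eq with ha | ha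
  · left
    obtain ⟨y, hy, hB, hyy⟩ := exists_form_pow_self_eq_zero hδ hx hy hn hB ha
    refine ⟨a, n, hbot, Or.inl ha, exists_delta_isEmbedding hδ hx hy hn hB (fun k => ?_) hyy⟩
    by_cases hk : n < k
    · simp [pow_eq_zero_of_lt hn hk]
    · refine form_pow_eq_zero hδ hx hx fun h => hk ?_
      have : (n : ℚ) < k := by linarith
      exact_mod_cast this
  have hna : (n : ℚ) - a = a := by linarith
  rw [hna] at hy
  rcases Nat.even_or_odd n with he | ho
  · left
    have key : ∀ z ∈ S.component a, ∀ k, S.form ((δ ^ k) z) z = 0 := by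
      intro z hz k
      by_cases hk : k = n
      · rw [hk]; exact form_pow_self_of_even hδ he z
      · refine form_pow_eq_zero hδ hz hz fun h => hk ?_
        have : (k : ℚ) = n := by linarith
        exact_mod_cast this
    exact ⟨a, n, hbot, Or.inr ⟨ha, he⟩,
      exists_delta_isEmbedding hδ hx (by rwa [hna]) hn hB (key x hx) (key y hy)⟩
  · right
    obtain ⟨p, rfl⟩ := ho
    have hap : a = (p : ℚ) + 1 / 2 := by push_cast at ha; linarith
    subst hap
    refine ⟨p, ?_⟩
    have hsw := form_pow_swap_of_odd hδ ⟨p, rfl⟩ x y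
    -- Polarization: if `B_n(x, x)` and `B_n(y, y)` both vanish, then `B_n(x + y, x + y) = 2 B_n(x,
    -- y)` does not.
    by_cases hxx : S.form ((δ ^ (2 * p + 1)) x) x = 0
    · by_cases hyy : S.form ((δ ^ (2 * p + 1)) y) y = 0
      · refine ⟨x + y, Submodule.add_mem _ hx hy, hn, ?_⟩
        simp only [map_add, LinearMap.add_apply, hxx, hyy, ← hsw, zero_add, add_zero]
        intro h
        exact hB (add_self_eq_zero.1 h)
      · exact ⟨y, hy, hn, hyy⟩
    · exact ⟨x, hx, hn, hxx⟩

theorem string_form (hδ : δ ∈ S.spDegreeNegOne) {p : ℕ} {x : V} {c : K}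
    (hx : x ∈ S.component ((p : ℚ) + 1 / 2)) (hB : S.form ((δ ^ (2 * p + 1)) x) x = c * (-1) ^ p)
    (a b : Fin (2 * p + 2)) :
    S.form ((δ ^ (a : ℕ)) x) ((δ ^ (b : ℕ)) x) =
      if a.rev = b then c * (-1) ^ (a.val + p + 1) else 0 := by
  rw [form_pow_pow hδ]
  split_ifs with h
  · have hb : (b : ℕ) + a = 2 * p + 1 := by rw [← h, Fin.val_rev]; omega
    rw [add_comm (a : ℕ), hb, hB]
    -- Partners in a string have positions adding up to the odd number `2p + 1`, so their parities
    -- differ.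
    have h1 : ((-1 : K)) ^ (b : ℕ) * (-1) ^ (a : ℕ) = -1 := by
      rw [← pow_add, hb]
      exact Odd.neg_one_pow ⟨p, rfl⟩
    have h2 : ((-1 : K)) ^ (a : ℕ) * (-1) ^ (a : ℕ) = 1 := by
      rw [← mul_pow]; simp
    have h3 : ((-1 : K)) ^ (b : ℕ) = -(-1) ^ (a : ℕ) := by
      linear_combination (-1) ^ (a : ℕ) * h1 - (-1) ^ (b : ℕ) * h2
    rw [h3, pow_succ, pow_add]
    ring
  · rw [form_pow_eq_zero hδ hx hx, mul_zero]
    intro h'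
    apply h
    have : (a : ℕ) + (b : ℕ) = 2 * p + 1 := by
      have : (((a : ℕ) + (b : ℕ) : ℕ) : ℚ) = ((2 * p + 1 : ℕ) : ℚ) := by
        rw [h']; push_cast; ring
      exact_mod_cast this
    rw [Fin.ext_iff, Fin.val_rev]
    omega

theorem exists_tau_isEmbedding [CharZero K] (hδ : δ ∈ S.spDegreeNegOne) {p : ℕ} {x : V}
    (hx : x ∈ S.component ((p : ℚ) + 1 / 2)) (hn : δ ^ (2 * p + 2) = 0)
    (hB : S.form ((δ ^ (2 * p + 1)) x) x = (-1) ^ p) :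
    ∃ φ, IsEmbedding ((BlockLabel.tau p).space K) ((BlockLabel.tau p).endo K) S δ φ := by
  have hf := string_form (c := 1) hδ hx (by rw [hB, one_mul])
  refine ⟨_, isEmbedding_constr (BlockLabel.tau p)
    (fun i : Fin (2 * p + 2) => (δ ^ (i : ℕ)) x) (fun i => S.pow_apply_mem hδ _ hx)
    (fun i j => ?_) (fun i => ?_)⟩
  · rw [hf]
    refine if_congr Iff.rfl ?_ rfl
    simp [BlockLabel.sgn]
  · change δ ((δ ^ (i : Fin (2 * p + 2)).val) x) =
      (BlockLabel.finNext (i : Fin (2 * p + 2))).elim 0 _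
    rw [← Module.End.mul_apply, ← pow_succ']
    unfold BlockLabel.finNext
    split_ifs with h
    · simp [BlockLabel.coeff]
    · rw [pow_eq_zero_of_le (by omega) hn]; rfl

theorem exists_negTau_isEmbedding [CharZero K] (hδ : δ ∈ S.spDegreeNegOne) {p : ℕ} {x : V}
    (hx : x ∈ S.component ((p : ℚ) + 1 / 2)) (hn : δ ^ (2 * p + 2) = 0)
    (hB : S.form ((δ ^ (2 * p + 1)) x) x = - (-1) ^ p) :
    ∃ φ, IsEmbedding ((BlockLabel.negTau p).space K) ((BlockLabel.negTau p).endo K) S δ φ := by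
  have hf := string_form (c := -1) hδ hx (by rw [hB, neg_one_mul])
  -- The alternating signs turn `δ` into minus the shift, and multiply the pairing of partners by
  -- `(-1)^(2p+1) = -1`, which cancels the sign in `hB`.
  refine ⟨_, isEmbedding_constr (BlockLabel.negTau p)
    (fun i : Fin (2 * p + 2) => (-1 : K) ^ (i : ℕ) • (δ ^ (i : ℕ)) x)
    (fun i => Submodule.smul_mem _ _ (S.pow_apply_mem hδ _ hx)) (fun i j => ?_) (fun i => ?_)⟩
  · change Fin (2 * p + 2) at i j
    rw [map_smul, map_smul, LinearMap.smul_apply, hf, smul_eq_mul, smul_eq_mul]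
    change _ = if i.rev = j then _ else _
    split_ifs with h
    · have hj : (j : ℕ) + i = 2 * p + 1 := by rw [← h, Fin.val_rev]; omega
      rw [← mul_assoc, ← pow_add, hj, Odd.neg_one_pow ⟨p, rfl⟩]
      simp [BlockLabel.sgn]
    · simp
  · change δ (_ • (δ ^ (i : Fin (2 * p + 2)).val) x) =
      (BlockLabel.finNext (i : Fin (2 * p + 2))).elim 0 _
    rw [map_smul, ← Module.End.mul_apply, ← pow_succ']
    unfold BlockLabel.finNext
    split_ifs with h
    · simp [BlockLabel.coeff, pow_succ]
    · rw [pow_eq_zero_of_le (by omega) hn]; simp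

end Existence

/-! ### The blocks available for each grading and field -/

section Main

variable {V : Type*} [AddCommGroup V]

theorem exists_integer_block {K : Type*} [Field K] [CharZero K] [Module K V]
    [FiniteDimensional K V] [Nontrivial V]
    (S : GradedSymplecticSpace K V) (hD : S.DegreesIn integerDegrees) (δ : Module.End K V)
    (hδ : δ ∈ S.spDegreeNegOne) :
    ∃ b ∈ BlockLabel.integerLabels, ∃ φ, IsEmbedding (b.space K) (b.endo K) S δ φ := by
  rcases exists_delta_or_string hδ with ⟨a, n, ha, hn, hφ⟩ | ⟨p, x, hx, -, hB⟩
  · obtain ⟨k, rfl⟩ : a ∈ integerDegrees := by_contra fun h => ha (hD a h)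
    have hk : (n : ℤ) ≤ 2 * k := by
      have : (n : ℚ) ≤ 2 * k := hn.elim le_of_lt fun h => h.1.le
      exact_mod_cast this
    lift k to ℕ using by omega
    exact ⟨_, ⟨k, n, by omega, rfl⟩, hφ⟩
  · have : (p : ℚ) + 1 / 2 ∉ integerDegrees := by
      rintro ⟨k, hk⟩
      have : ((2 * p + 1 : ℤ) : ℚ) = (2 * k : ℤ) := by push_cast; linarith
      have := Int.cast_injective this
      omega
    rw [hD _ this, Submodule.mem_bot] at hx
    simp [hx] at hB

theorem exists_halfOdd_block_or_string {K : Type*} [Field K] [CharZero K] [Module K V]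
    [FiniteDimensional K V] [Nontrivial V]
    {S : GradedSymplecticSpace K V} (hD : S.DegreesIn halfOddDegrees) {δ : Module.End K V}
    (hδ : δ ∈ S.spDegreeNegOne) :
    (∃ b ∈ BlockLabel.halfOddDeltaLabels, ∃ φ, IsEmbedding (b.space K) (b.endo K) S δ φ) ∨
    ∃ p : ℕ, ∃ x ∈ S.component ((p : ℚ) + 1 / 2), δ ^ (2 * p + 2) = 0 ∧
      S.form ((δ ^ (2 * p + 1)) x) x ≠ 0 := by
  refine (exists_delta_or_string hδ).imp_left ?_
  rintro ⟨a, n, ha, hn, hφ⟩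
  obtain ⟨k, rfl⟩ : a ∈ halfOddDegrees := by_contra fun h => ha (hD a h)
  have hk : (n : ℤ) < 2 * k + 1 := by
    rcases hn with hn | ⟨hn, he⟩
    · have : (n : ℚ) < 2 * k + 1 := by linarith
      exact_mod_cast this
    -- The boundary case `n = 2a` with `n` even is impossible, as `2a` is odd here; this is why `l ≤
    -- 2s - 1`.
    · have : (n : ℚ) = 2 * k + 1 := by linarith
      have : (n : ℤ) = 2 * k + 1 := by exact_mod_cast this
      obtain ⟨m, rfl⟩ := he
      omega
  lift k to ℕ using by omega
  exact ⟨_, ⟨k, n, by omega, rfl⟩, hφ⟩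

theorem exists_complex_block [Module ℂ V] [FiniteDimensional ℂ V] [Nontrivial V]
    (S : GradedSymplecticSpace ℂ V) (hD : S.DegreesIn halfOddDegrees) (δ : Module.End ℂ V)
    (hδ : δ ∈ S.spDegreeNegOne) :
    ∃ b ∈ BlockLabel.halfOddDeltaLabels ∪ BlockLabel.tauLabels,
      ∃ φ, IsEmbedding (b.space ℂ) (b.endo ℂ) S δ φ := by
  rcases exists_halfOdd_block_or_string hD hδ with ⟨b, hb, h⟩ | ⟨p, x, hx, hn, hB⟩
  · exact ⟨b, Or.inl hb, h⟩
  · refine ⟨_, Or.inr ⟨p, rfl⟩, ?_⟩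
    obtain ⟨c, hc⟩ := IsAlgClosed.exists_pow_nat_eq
      ((-1) ^ p / S.form ((δ ^ (2 * p + 1)) x) x) (n := 2) (by norm_num)
    refine exists_tau_isEmbedding (x := c • x) hδ (Submodule.smul_mem _ _ hx) hn ?_
    simp only [map_smul, LinearMap.smul_apply, smul_eq_mul]
    rw [← mul_assoc, ← sq, hc, div_mul_cancel₀ _ hB]

theorem exists_real_block [Module ℝ V] [FiniteDimensional ℝ V] [Nontrivial V]
    (S : GradedSymplecticSpace ℝ V) (hD : S.DegreesIn halfOddDegrees) (δ : Module.End ℝ V)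
    (hδ : δ ∈ S.spDegreeNegOne) :
    ∃ b ∈ BlockLabel.halfOddDeltaLabels ∪ BlockLabel.tauLabels ∪ BlockLabel.negTauLabels,
      ∃ φ, IsEmbedding (b.space ℝ) (b.endo ℝ) S δ φ := by
  rcases exists_halfOdd_block_or_string hD hδ with ⟨b, hb, h⟩ | ⟨p, x, hx, hn, hB⟩
  · exact ⟨b, Or.inl (Or.inl hb), h⟩
  -- Rescaling `x` multiplies `B(x, x)` by a square, so over the reals it can be normalized only to
  -- a value of the same sign.
  have key : ∀ r : ℝ, 0 < r / S.form ((δ ^ (2 * p + 1)) x) x →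
      ∃ x ∈ S.component ((p : ℚ) + 1 / 2), S.form ((δ ^ (2 * p + 1)) x) x = r := by
    intro r hr
    refine ⟨√(r / S.form ((δ ^ (2 * p + 1)) x) x) • x, Submodule.smul_mem _ _ hx, ?_⟩
    simp only [map_smul, LinearMap.smul_apply, smul_eq_mul]
    rw [← mul_assoc, Real.mul_self_sqrt hr.le, div_mul_cancel₀ _ hB]
  have hne : (-1) ^ p / S.form ((δ ^ (2 * p + 1)) x) x ≠ 0 := div_ne_zero (by simp) hB
  rcases hne.lt_or_gt with h | h
  · obtain ⟨y, hy, hy'⟩ := key (- (-1) ^ p) (by rw [neg_div]; linarith)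
    exact ⟨_, Or.inr ⟨p, rfl⟩, exists_negTau_isEmbedding hδ hy hn hy'⟩
  · obtain ⟨y, hy, hy'⟩ := key _ h
    exact ⟨_, Or.inl (Or.inr ⟨p, rfl⟩), exists_tau_isEmbedding hδ hy hn hy'⟩

end Main

end GradedSymplecticSpace

/-! ### Powers of block endomorphisms and their ranks -/

namespace BlockLabel

/-- The position of a basis vector in its row. -/
def pos : ∀ b : BlockLabel, b.Index → ℕ
  | delta _ _, Sum.inl a => a.val
  | delta _ _, Sum.inr a => a.val
  | tau _, a => a.val
  | negTau _, a => a.val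

/-- The `k`-th successor of an index in `{0, …, n - 1}`, if there is one. -/
def finShift {n : ℕ} (k : ℕ) (a : Fin n) : Option (Fin n) :=
  if h : a.val + k < n then some ⟨a.val + k, h⟩ else none

theorem finShift_eq {n k : ℕ} (a b : Fin n) : finShift k a = some b ↔ b.val = a.val + k := by
  unfold finShift; split_ifs with h
  · simp [Fin.ext_iff, eq_comm]
  · simp; omega

theorem finShift_eq_none {n k : ℕ} (a : Fin n) : finShift k a = none ↔ n ≤ a.val + k := by
  unfold finShift; split_ifs with h
  · simp; omega
  · simp; omega

theorem finShift_zero {n : ℕ} (a : Fin n) : finShift 0 a = some a := by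
  simp [finShift_eq]

theorem finShift_bind_finNext {n k : ℕ} (a : Fin n) :
    (finShift k a).bind finNext = finShift (k + 1) a := by
  unfold finShift
  split_ifs with h h' h'
  · simp [finNext_eq]; omega
  · simp [finNext]; omega
  · omega
  · rfl

/-- The basis vector to which the `k`-th power of the endomorphism of a block sends a given basis
vector, up to sign. -/
def shift (k : ℕ) : ∀ b : BlockLabel, b.Index → Option b.Index
  | delta _ _, Sum.inl a => (finShift k a).map Sum.inl
  | delta _ _, Sum.inr a => (finShift k a).map Sum.inr
  | tau _, a => finShift k a
  | negTau _, a => finShift k a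

theorem shift_zero (b : BlockLabel) (a : b.Index) : b.shift 0 a = some a := by
  rcases b with ⟨s, l⟩ | p | p
  · rcases a with a | a <;> simp [shift, finShift_zero]
  · exact finShift_zero _
  · exact finShift_zero _

theorem shift_bind_next (b : BlockLabel) (k : ℕ) (a : b.Index) :
    (b.shift k a).bind b.next = b.shift (k + 1) a := by
  rcases b with ⟨s, l⟩ | p | p
  · rcases a with a | a
    · simp only [shift, ← finShift_bind_finNext (k := k)]
      rcases finShift k a with _ | c <;> simp [next]
    · simp only [shift, ← finShift_bind_finNext (k := k)]
      rcases finShift k a with _ | c <;> simp [next]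
  · exact finShift_bind_finNext _
  · exact finShift_bind_finNext _

theorem deg_of_shift_eq {b : BlockLabel} {k : ℕ} {a c : b.Index} (h : b.shift k a = some c) :
    b.deg c = b.deg a - k := by
  rcases b with ⟨s, l⟩ | p | p
  · rcases a with a | a <;> rcases c with c | c <;> simp [shift, finShift_eq] at h <;>
      simp [deg, h] <;> ring
  · simp only [shift, finShift_eq] at h; simp [deg, h]; ring
  · simp only [shift, finShift_eq] at h; simp [deg, h]; ring

theorem pos_of_shift_eq {b : BlockLabel} {k : ℕ} {a c : b.Index} (h : b.shift k a = some c) :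
    b.pos c = b.pos a + k := by
  rcases b with ⟨s, l⟩ | p | p
  · rcases a with a | a <;> rcases c with c | c <;> simp [shift, finShift_eq] at h <;>
      simp [pos, h]
  · simp only [shift, finShift_eq] at h; simp [pos, h]
  · simp only [shift, finShift_eq] at h; simp [pos, h]

theorem exists_shift_eq {b : BlockLabel} {k : ℕ} {c : b.Index} (h : k ≤ b.pos c) :
    ∃ a, b.shift k a = some c := by
  have key : ∀ {n : ℕ} (c : Fin n), k ≤ c.val → ∃ a, finShift k a = some c := fun c hc =>
    ⟨⟨c.val - k, by omega⟩, by rw [finShift_eq]; simp; omega⟩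
  rcases b with ⟨s, l⟩ | p | p
  · rcases c with c | c
    · obtain ⟨a, ha⟩ := key c h
      exact ⟨Sum.inl a, by simp [shift, ha]⟩
    · obtain ⟨a, ha⟩ := key c h
      exact ⟨Sum.inr a, by simp [shift, ha]⟩
  · exact key _ h
  · exact key _ h

theorem shift_injective {b : BlockLabel} {k : ℕ} {a a' c : b.Index} (h : b.shift k a = some c)
    (h' : b.shift k a' = some c) : a = a' := by
  rcases b with ⟨s, l⟩ | p | p
  · rcases a with a | a <;> rcases a' with a' | a' <;> rcases c with c | c <;>
      simp [shift, finShift_eq] at h h' <;> simp [Fin.ext_iff] <;> omega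
  · simp only [shift, finShift_eq] at h h'
    exact Fin.ext (by omega)
  · simp only [shift, finShift_eq] at h h'
    exact Fin.ext (by omega)

theorem coeff_ne_zero (b : BlockLabel) : b.coeff ≠ 0 := by
  rcases b with ⟨s, l⟩ | p | p <;> simp [coeff]

theorem endo_pow_single {K : Type*} [Field K] (b : BlockLabel) (k : ℕ) (a : b.Index) :
    (b.endo K ^ k) (Pi.single a 1) =
      (b.shift k a).elim 0 fun c => Pi.single c ((b.coeff : K) ^ k) := by
  induction k with
  | zero => simp [shift_zero]
  | succ k ih =>
    rw [pow_succ', Module.End.mul_apply, ih, ← shift_bind_next]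
    rcases b.shift k a with _ | c
    · simp
    · have : (Pi.single c ((b.coeff : K) ^ k) : b.Index → K) =
          (b.coeff : K) ^ k • Pi.single c 1 := by
        rw [← Pi.single_smul, smul_eq_mul, mul_one]
      simp only [Option.elim, this, map_smul, endo, GradedSymplecticSpace.ofBasisEnd_single,
        Option.bind_some]
      rcases b.next c with _ | d
      · simp
      · simp only [← Pi.single_smul, smul_eq_mul, pow_succ]

theorem sumEndo_pow_apply {K : Type*} [Field K] {N : ℕ} (t : Fin N → BlockLabel) (k : ℕ)
    (x : ∀ j, (t j).Index → K) (j : Fin N) :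
    (sumEndo K t ^ k) x j = ((t j).endo K ^ k) (x j) := by
  induction k generalizing x with
  | zero => simp
  | succ k ih =>
    rw [pow_succ, Module.End.mul_apply, ih, pow_succ, Module.End.mul_apply]
    rfl

section Rank

variable (K : Type*) [Field K] {N : ℕ} (t : Fin N → BlockLabel)

/-- The standard basis of a direct sum of blocks. -/
noncomputable def sumBasis : Module.Basis (Σ j, (t j).Index) K (∀ j, (t j).Index → K) :=
  Pi.basis fun j => Pi.basisFun K (t j).Index

theorem sumBasis_apply (x : Σ j, (t j).Index) :
    sumBasis K t x = Pi.single x.1 (Pi.single x.2 1) := by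
  rw [sumBasis, Pi.basis_apply, Pi.basisFun_apply]

theorem sumBasis_repr (y : ∀ j, (t j).Index → K) (x : Σ j, (t j).Index) :
    (sumBasis K t).repr y x = y x.1 x.2 := by
  rw [sumBasis, Pi.basis_repr, Pi.basisFun_repr]

theorem sumEndo_pow_sumBasis (k : ℕ) (x : Σ j, (t j).Index) :
    (sumEndo K t ^ k) (sumBasis K t x) =
      ((t x.1).shift k x.2).elim 0 fun c => ((t x.1).coeff : K) ^ k • sumBasis K t ⟨x.1, c⟩ := by
  obtain ⟨j, a⟩ := x
  funext i
  rw [sumEndo_pow_apply, sumBasis_apply]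
  by_cases hi : i = j
  · subst hi
    simp only [Pi.single_eq_same, endo_pow_single]
    rcases (t i).shift k a with _ | c
    · simp
    · simp [sumBasis_apply, ← Pi.single_smul]
  · rw [Pi.single_eq_of_ne hi, map_zero]
    rcases (t j).shift k a with _ | c
    · simp
    · simp [sumBasis_apply, Pi.single_eq_of_ne hi]

variable [CharZero K]

theorem sumSpace_component (i : ℚ) : (sumSpace K t).component i =
    Submodule.span K (sumBasis K t '' {x | (t x.1).deg x.2 = i}) := by
  refine le_antisymm (fun y hy => ?_) (Submodule.span_le.2 ?_)
  · rw [← (sumBasis K t).sum_repr y]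
    refine Submodule.sum_mem _ fun x _ => ?_
    rw [sumBasis_repr]
    by_cases hx : y x.1 x.2 = 0
    · simp [hx]
    · exact Submodule.smul_mem _ _ (Submodule.subset_span ⟨x, hy x.1 trivial x.2 hx, rfl⟩)
  · rintro _ ⟨⟨j, a⟩, hx, rfl⟩ j' _ a' ha'
    rw [sumBasis_apply] at ha'
    by_cases hj : j' = j
    · subst hj
      rw [Pi.single_eq_same] at ha'
      by_cases ha : a' = a
      · rw [ha]; exact hx
      · exact absurd (Pi.single_eq_of_ne ha _) ha'
    · rw [Pi.single_eq_of_ne hj] at ha'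
      exact absurd rfl ha'

/-- The `k`-th power sends each basis vector to zero or to a nonzero multiple of another one, and
the vectors reached are those with at least `k` predecessors in their row. -/
theorem map_pow_sumSpace_component (d : ℚ) (k : ℕ) :
    ((sumSpace K t).component (d + k)).map (sumEndo K t ^ k) =
      Submodule.span K (sumBasis K t '' {x | (t x.1).deg x.2 = d ∧ k ≤ (t x.1).pos x.2}) := by
  rw [sumSpace_component, Submodule.map_span]
  refine le_antisymm (Submodule.span_le.2 ?_) (Submodule.span_le.2 ?_)
  · rintro _ ⟨_, ⟨⟨j, a⟩, hx, rfl⟩, rfl⟩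
    rw [sumEndo_pow_sumBasis]
    rcases hc : (t j).shift k a with _ | c
    · exact Submodule.zero_mem _
    · refine Submodule.smul_mem _ _ (Submodule.subset_span ⟨⟨j, c⟩, ⟨?_, ?_⟩, rfl⟩)
      · rw [deg_of_shift_eq hc, show (t j).deg a = d + k from hx]; ring
      · rw [pos_of_shift_eq hc]; omega
  · rintro _ ⟨⟨j, c⟩, ⟨hd, hk⟩, rfl⟩
    obtain ⟨a, ha⟩ := exists_shift_eq hk
    have hcoe : ((t j).coeff : K) ^ k ≠ 0 :=
      pow_ne_zero _ (by exact_mod_cast coeff_ne_zero (t j))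
    have h := sumEndo_pow_sumBasis K t k ⟨j, a⟩
    simp only [ha, Option.elim] at h
    rw [SetLike.mem_coe, ← Submodule.smul_mem_iff _ hcoe, ← h]
    refine Submodule.subset_span ⟨_, ⟨⟨j, a⟩, ?_, rfl⟩, rfl⟩
    have := deg_of_shift_eq ha
    change (t j).deg a = d + k
    linarith [show (t j).deg c = d from hd]

theorem finrank_map_pow (d : ℚ) (k : ℕ) :
    Module.finrank K (((sumSpace K t).component (d + k)).map (sumEndo K t ^ k)) =
      ∑ j, ∑ a : (t j).Index, if (t j).deg a = d ∧ k ≤ (t j).pos a then 1 else 0 := by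
  have h := finrank_span_eq_card ((sumBasis K t).linearIndependent.comp
    (Subtype.val : {x : Σ j, (t j).Index // (t x.1).deg x.2 = d ∧ k ≤ (t x.1).pos x.2} → _)
    Subtype.val_injective)
  rw [Set.range_comp, Subtype.range_coe_subtype] at h
  rw [map_pow_sumSpace_component, h,
    ← Fintype.sum_sigma' (fun j a => if (t j).deg a = d ∧ k ≤ (t j).pos a then 1 else 0),
    Finset.sum_boole, Fintype.card_subtype]
  rfl

end Rank

theorem finrank_map_pow_eq {K V W : Type*} [Field K] [AddCommGroup V] [Module K V]
    [AddCommGroup W] [Module K W] {S : GradedSymplecticSpace K V} {δ : Module.End K V}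
    {T : GradedSymplecticSpace K W} {ε : Module.End K W} (h : S.IsConj δ T ε) (i : ℚ) (k : ℕ) :
    Module.finrank K ((S.component i).map (δ ^ k)) =
      Module.finrank K ((T.component i).map (ε ^ k)) := by
  obtain ⟨φ, -, h2, h3⟩ := h
  have hcomm : ∀ x, φ ((δ ^ k) x) = (ε ^ k) (φ x) := by
    intro x
    induction k generalizing x with
    | zero => simp
    | succ k ih => rw [pow_succ, Module.End.mul_apply, ih, h3, pow_succ, Module.End.mul_apply]
  have : (T.component i).map (ε ^ k) = ((S.component i).map (δ ^ k)).map (φ : V →ₗ[K] W) := by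
    rw [← h2, ← Submodule.map_comp, ← Submodule.map_comp]
    congr 1
    ext x
    exact (hcomm x).symm
  rw [this]
  exact (LinearEquiv.finrank_map_eq φ _).symm

/-- The number of rows of a block whose first vector has degree `s` and that have more than `k`
vectors. -/
def rowCount : BlockLabel → ℚ → ℕ → ℕ
  | delta s' l, s, k => (if k ≤ l ∧ s' = s then 1 else 0) + if k ≤ l ∧ l - s' = s then 1 else 0
  | tau p, s, k => if k ≤ 2 * p + 1 ∧ (p : ℚ) + 1 / 2 = s then 1 else 0
  | negTau p, s, k => if k ≤ 2 * p + 1 ∧ (p : ℚ) + 1 / 2 = s then 1 else 0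

/-- A row with top degree `r` has at position `k` at most one vector, of degree `r - k`. Fixing both
degree and position therefore counts rows by top degree. -/
theorem sum_deg_pos_eq (b : BlockLabel) (s : ℚ) (k : ℕ) :
    (∑ a : b.Index, if b.deg a = s - k ∧ b.pos a = k then 1 else 0) = b.rowCount s k := by
  have key : ∀ (n : ℕ) (r : ℚ), (∑ a : Fin (n + 1), if r - (a.val : ℚ) = s - k ∧ a.val = k
      then 1 else 0) = if k ≤ n ∧ r = s then 1 else 0 := by
    intro n r
    by_cases hk : k ≤ n
    · rw [Finset.sum_eq_single (⟨k, by omega⟩ : Fin (n + 1))]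
      · simp [hk]
      · intro a _ ha
        rw [if_neg]
        exact fun h => ha (Fin.ext h.2)
      · simp
    · rw [if_neg (fun h => hk h.1)]
      refine Finset.sum_eq_zero fun a _ => if_neg fun h => ?_
      have := a.2
      omega
  rcases b with ⟨s', l⟩ | p | p
  · rw [Fintype.sum_sum_type]
    exact congr_arg₂ (· + ·) (key l s') (key l (l - s'))
  · exact key (2 * p + 1) _
  · exact key (2 * p + 1) _

/-- Two conjugate direct sums of blocks have the same numbers of rows of each kind. -/
theorem sum_rowCount_eq {K : Type*} [Field K] [CharZero K] {N N' : ℕ} {t : Fin N → BlockLabel}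
    {t' : Fin N' → BlockLabel}
    (h : (sumSpace K t).IsConj (sumEndo K t) (sumSpace K t') (sumEndo K t')) (s : ℚ) (k : ℕ) :
    ∑ j, (t j).rowCount s k = ∑ j, (t' j).rowCount s k := by
  have hR : ∀ (d : ℚ) (k : ℕ), (∑ j, ∑ a : (t j).Index, if (t j).deg a = d ∧ k ≤ (t j).pos a
      then 1 else 0) =
      ∑ j, ∑ a : (t' j).Index, if (t' j).deg a = d ∧ k ≤ (t' j).pos a then 1 else 0 :=
    fun d k => by rw [← finrank_map_pow K, ← finrank_map_pow K, finrank_map_pow_eq h]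
  have hA : ∀ {M : ℕ} (u : Fin M → BlockLabel),
      (∑ j, ∑ a : (u j).Index, if (u j).deg a = s - k ∧ k ≤ (u j).pos a then 1 else 0) =
      ∑ j, (u j).rowCount s k +
        ∑ j, ∑ a : (u j).Index, if (u j).deg a = s - k ∧ k + 1 ≤ (u j).pos a then 1 else 0 := by
    intro M u
    simp only [← sum_deg_pos_eq, ← Finset.sum_add_distrib]
    refine Finset.sum_congr rfl fun j _ => Finset.sum_congr rfl fun a _ => ?_
    rcases lt_trichotomy k ((u j).pos a) with hk | hk | hk <;>
      by_cases hd : (u j).deg a = s - k <;> simp [hd] <;> grind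
  have h1 := hA t
  have h2 := hA t'
  -- The number of rows is the rank of `δ^k` on degree `s` minus the rank of `δ^(k+1)` on degree `s
  -- + 1`; both land in degree `s - k`.
  have h3 := hR (s - k) k
  have h4 := hR (s - k) (k + 1)
  omega

/-- The labels that occur in the classification, for any of the gradings and fields. -/
def Admissible : BlockLabel → Prop
  | delta s l => (l : ℚ) < 2 * s ∨ (l : ℚ) = 2 * s ∧ Even l
  | tau _ => True
  | negTau _ => True

/-! ### Multiplicities recovered from row counts -/

theorem admissible_of_mem_integerLabels {b : BlockLabel} (h : b ∈ integerLabels) :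
    b.Admissible := by
  obtain ⟨k, l, hl, rfl⟩ := h
  rcases hl.lt_or_eq with hl | hl
  · left; exact_mod_cast hl
  · right; exact ⟨by exact_mod_cast hl, hl ▸ even_two_mul k⟩

theorem admissible_of_mem_halfOddDeltaLabels {b : BlockLabel} (h : b ∈ halfOddDeltaLabels) :
    b.Admissible := by
  obtain ⟨k, l, hl, rfl⟩ := h
  left
  have : (l : ℚ) ≤ 2 * k := by exact_mod_cast hl
  linarith

open Classical in
theorem multiplicity_eq_sum {N : ℕ} (t : Fin N → BlockLabel) (b : BlockLabel) :
    multiplicity t b = ∑ j, if t j = b then 1 else 0 := by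
  rw [multiplicity, Nat.card_eq_fintype_card, Fintype.card_subtype, Finset.sum_boole]
  rfl

theorem multiplicity_eq_zero {N : ℕ} {t : Fin N → BlockLabel} {b : BlockLabel}
    (h : ∀ j, t j ≠ b) : multiplicity t b = 0 := by
  classical
  rw [multiplicity_eq_sum]
  exact Finset.sum_eq_zero fun j _ => if_neg (h j)

open Classical in
-- The drop from `l` to `l + 1` counts rows with top degree `s` and exactly `l + 1` vectors. A
-- second row of some `δ_{s';l}` would need `s' = l - s < l / 2`, against admissibility, and rows of
-- `±τ` satisfy `l = 2s`.
theorem rowCount_delta_of_lt {s : ℚ} {l : ℕ} (h : (l : ℚ) < 2 * s) {b : BlockLabel}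
    (hb : b.Admissible) :
    b.rowCount s l = b.rowCount s (l + 1) + if b = delta s l then 1 else 0 := by
  rcases b with ⟨s', l'⟩ | p | p
  · simp only [rowCount, delta.injEq]
    rcases lt_trichotomy l l' with hl | rfl | hl
    · simp [hl.le, Nat.succ_le_of_lt hl, hl.ne']
    · have : ¬ (l : ℚ) - s' = s := fun hs => by
        rcases hb with hb | ⟨hb, -⟩ <;> linarith
      simp [this]
    · have h1 : ¬ l ≤ l' := by omega
      have h2 : ¬ l + 1 ≤ l' := by omega
      simp [h1, h2, hl.ne]
  all_goals
    simp only [rowCount, reduceCtorEq, if_false, add_zero]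
    refine if_congr ⟨fun h' => ⟨?_, h'.2⟩, fun h' => ⟨by omega, h'.2⟩⟩ rfl rfl
    have h1 : (l : ℚ) < 2 * p + 1 := by linarith [h'.2]
    have h2 : l < 2 * p + 1 := by exact_mod_cast h1
    omega

open Classical in
-- When `l = 2s`, both rows of `δ_{s;l}` start in degree `s`, hence the factor `2`; rows of `±τ` are
-- excluded by parity.
theorem rowCount_delta_of_eq {s : ℚ} {l : ℕ} (h : (l : ℚ) = 2 * s) (he : Even l) {b : BlockLabel}
    (hb : b.Admissible) :
    b.rowCount s l = b.rowCount s (l + 1) + 2 * if b = delta s l then 1 else 0 := by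
  rcases b with ⟨s', l'⟩ | p | p
  · simp only [rowCount, delta.injEq]
    rcases lt_trichotomy l l' with hl | rfl | hl
    · simp [hl.le, Nat.succ_le_of_lt hl, hl.ne']
    · have : (l : ℚ) - s' = s ↔ s' = s := by constructor <;> (intro hs; linarith)
      simp only [this]
      by_cases hs : s' = s <;> simp [hs]
    · have h1 : ¬ l ≤ l' := by omega
      have h2 : ¬ l + 1 ≤ l' := by omega
      simp [h1, h2, hl.ne]
  all_goals
    simp only [rowCount, reduceCtorEq, if_false, mul_zero, add_zero]
    refine if_congr ⟨fun h' => ?_, fun h' => ⟨by omega, h'.2⟩⟩ rfl rfl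
    have h1 : (l : ℚ) = 2 * p + 1 := by linarith [h'.2]
    have h2 : l = 2 * p + 1 := by exact_mod_cast h1
    rw [h2] at he
    exact absurd he (by simp)

open Classical in
-- An admissible `δ_{s;l}` with a row of this shape would have `l = 2s` odd. The row shape alone
-- cannot tell `τ` from `-τ`.
theorem rowCount_tau (p : ℕ) {b : BlockLabel} (hb : b.Admissible) :
    b.rowCount ((p : ℚ) + 1 / 2) (2 * p + 1) = b.rowCount ((p : ℚ) + 1 / 2) (2 * p + 2) +
      ((if b = tau p then 1 else 0) + if b = negTau p then 1 else 0) := by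
  rcases b with ⟨s, l⟩ | q | q
  · simp only [rowCount, reduceCtorEq, if_false, add_zero]
    rcases lt_trichotomy (2 * p + 1) l with hl | hl | hl
    · simp [hl.le, Nat.succ_le_of_lt hl]
    · have hl' : (l : ℚ) = 2 * p + 1 := by rw [← hl]; push_cast; ring
      have hs : s ≠ (p : ℚ) + 1 / 2 := by
        rintro rfl
        rcases hb with hb | ⟨-, hb⟩
        · linarith
        · rw [← hl] at hb; exact absurd hb (by simp)
      have hs' : (l : ℚ) - s ≠ (p : ℚ) + 1 / 2 := fun h => hs (by linarith)
      simp only [hs, hs', and_false]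
    · have h1 : ¬ 2 * p + 1 ≤ l := by omega
      have h2 : ¬ 2 * p + 2 ≤ l := by omega
      simp [h1, h2]
  all_goals
    by_cases hq : q = p
    · subst hq; simp [rowCount]
    · simp [rowCount, hq]

/-- In conjugate direct sums of blocks the blocks `δ_{s;l}` have the same multiplicities. -/
theorem multiplicity_delta_eq {K : Type*} [Field K] [CharZero K] {N N' : ℕ}
    {t : Fin N → BlockLabel} {t' : Fin N' → BlockLabel} (ht : ∀ j, (t j).Admissible)
    (ht' : ∀ j, (t' j).Admissible)
    (h : (sumSpace K t).IsConj (sumEndo K t) (sumSpace K t') (sumEndo K t')) (s : ℚ) (l : ℕ) :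
    multiplicity t (delta s l) = multiplicity t' (delta s l) := by
  classical
  by_cases hsl : (delta s l).Admissible
  · have h1 := sum_rowCount_eq h s l
    have h2 := sum_rowCount_eq h s (l + 1)
    rw [multiplicity_eq_sum, multiplicity_eq_sum]
    rcases hsl with hsl | ⟨hsl, he⟩
    · simp only [fun j => rowCount_delta_of_lt hsl (ht j), fun j => rowCount_delta_of_lt hsl (ht' j),
        Finset.sum_add_distrib] at h1
      omega
    · simp only [fun j => rowCount_delta_of_eq hsl he (ht j),
        fun j => rowCount_delta_of_eq hsl he (ht' j), Finset.sum_add_distrib,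
        ← Finset.mul_sum] at h1
      omega
  · rw [multiplicity_eq_zero (t := t) fun j hj => hsl (by rw [← hj]; exact ht j),
      multiplicity_eq_zero (t := t') fun j hj => hsl (by rw [← hj]; exact ht' j)]

/-- In conjugate direct sums of blocks, `τ_m` and `-τ_m` have the same total multiplicity. -/
theorem multiplicity_tau_add_eq {K : Type*} [Field K] [CharZero K] {N N' : ℕ}
    {t : Fin N → BlockLabel} {t' : Fin N' → BlockLabel} (ht : ∀ j, (t j).Admissible)
    (ht' : ∀ j, (t' j).Admissible)
    (h : (sumSpace K t).IsConj (sumEndo K t) (sumSpace K t') (sumEndo K t')) (p : ℕ) :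
    multiplicity t (tau p) + multiplicity t (negTau p) =
      multiplicity t' (tau p) + multiplicity t' (negTau p) := by
  classical
  have h1 := sum_rowCount_eq h ((p : ℚ) + 1 / 2) (2 * p + 1)
  have h2 := sum_rowCount_eq h ((p : ℚ) + 1 / 2) (2 * p + 2)
  simp only [multiplicity_eq_sum]
  simp only [fun j => rowCount_tau p (ht j), fun j => rowCount_tau p (ht' j),
    Finset.sum_add_distrib] at h1
  omega

/-- Direct sums of blocks that differ by the order of the summands are conjugate. -/
theorem isConj_sum_of_multiplicity_eq (K : Type*) [Field K] [CharZero K] {N N' : ℕ}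
    {t : Fin N → BlockLabel} {t' : Fin N' → BlockLabel}
    (h : ∀ b, multiplicity t b = multiplicity t' b) :
    (sumSpace K t).IsConj (sumEndo K t) (sumSpace K t') (sumEndo K t') := by
  obtain ⟨e, rfl⟩ : ∃ e : Fin N ≃ Fin N', t = t' ∘ e := by
    -- Bijections between the fibres of `t` and `t'` over each label glue to a reindexing of the
    -- summands.
    have e : ∀ b, {j // t j = b} ≃ {j // t' j = b} := fun b => (Finite.card_eq.1 (h b)).some
    exact ⟨Equiv.ofFiberEquiv e, funext fun j => (Equiv.ofFiberEquiv_map e j).symm⟩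
  refine GradedSymplecticSpace.IsConj.symm (GradedSymplecticSpace.IsEmbedding.isConj
    (φ := LinearMap.pi fun j => LinearMap.proj (φ := fun j => (t' j).Index → K) (e j))
    ⟨fun x y => ?_, fun i x hx => ?_, fun x => rfl⟩ fun x => ?_)
  · exact e.sum_comp fun j => ((t' j).space K).form (x j) (y j)
  · exact fun j _ => hx (e j) trivial
  · refine ⟨Equiv.piCongrLeft (fun j => (t' j).Index → K) e x, funext fun j => ?_⟩
    exact Equiv.piCongrLeft_apply_apply (fun j => (t' j).Index → K) e x j

end BlockLabel

namespace BlockLabel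

/-! ### The law of inertia separating `τ` from `-τ` -/

section Signature

variable {K : Type*} [Field K]

theorem space_form_apply [CharZero K] (b : BlockLabel) (x y : b.Index → K) :
    (b.space K).form x y = ∑ a, (b.sgn a : K) * (x a * y (b.inv a)) :=
  rfl

theorem endo_pow_apply_eq_sum (b : BlockLabel) (k : ℕ) (x : b.Index → K) (c : b.Index) :
    (b.endo K ^ k) x c = ∑ a, if b.shift k a = some c then x a * (b.coeff : K) ^ k else 0 := by
  conv_lhs => rw [← Finset.univ_sum_single x]
  rw [map_sum, Finset.sum_apply]
  refine Finset.sum_congr rfl fun a _ => ?_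
  have : (Pi.single a (x a) : b.Index → K) = x a • Pi.single a 1 := by
    rw [← Pi.single_smul, smul_eq_mul, mul_one]
  rw [this, map_smul, endo_pow_single, Pi.smul_apply, smul_eq_mul]
  rcases b.shift k a with _ | d
  · simp
  · by_cases hd : d = c
    · subst hd; simp
    · simp [hd]

theorem endo_pow_apply_of_shift_eq {b : BlockLabel} {k : ℕ} {a c : b.Index}
    (h : b.shift k a = some c) (x : b.Index → K) :
    (b.endo K ^ k) x c = x a * (b.coeff : K) ^ k := by
  rw [endo_pow_apply_eq_sum, Finset.sum_eq_single a]
  · rw [if_pos h]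
  · exact fun d _ hd => if_neg fun h' => hd (shift_injective h' h)
  · simp

theorem exists_of_endo_pow_apply_ne_zero {b : BlockLabel} {k : ℕ} {x : b.Index → K} {c : b.Index}
    (h : (b.endo K ^ k) x c ≠ 0) : ∃ a, x a ≠ 0 ∧ b.shift k a = some c := by
  rw [endo_pow_apply_eq_sum] at h
  obtain ⟨a, -, ha⟩ := Finset.exists_ne_zero_of_sum_ne_zero h
  by_cases hs : b.shift k a = some c
  · rw [if_pos hs] at ha
    exact ⟨a, left_ne_zero_of_mul ha, hs⟩
  · rw [if_neg hs] at ha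
    exact absurd rfl ha

theorem shift_eq_none_of_endo_pow_eq_zero [CharZero K] {b : BlockLabel} {k : ℕ} {x : b.Index → K}
    (hx : (b.endo K ^ k) x = 0) {a : b.Index} (ha : x a ≠ 0) : b.shift k a = none := by
  rcases h : b.shift k a with _ | c
  · rfl
  · have h1 := endo_pow_apply_of_shift_eq h x
    rw [hx, Pi.zero_apply] at h1
    have h2 : (b.coeff : K) ≠ 0 := by exact_mod_cast coeff_ne_zero b
    exact absurd h1.symm (mul_ne_zero ha (pow_ne_zero _ h2))

/-- A nonzero term needs a coordinate of `x` that survives `2p + 1` steps and pairs with another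
coordinate, while `δ^(2p+2)` kills both. This forces `l = 2p + 1` and a row with top degree `p +
1/2`, so `l = 2s` is odd, which is not admissible. -/
theorem delta_form_eq_zero [CharZero K] {s : ℚ} {l p : ℕ} (hb : (delta s l).Admissible)
    {x : (delta s l).Index → K} (hx : x ∈ ((delta s l).space K).component ((p : ℚ) + 1 / 2))
    (hk : ((delta s l).endo K ^ (2 * p + 2)) x = 0) :
    ((delta s l).space K).form (((delta s l).endo K ^ (2 * p + 1)) x) x = 0 := by
  have hl : ∀ h : l = 2 * p + 1, s ≠ (p : ℚ) + 1 / 2 := by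
    rintro rfl rfl
    rcases hb with hb | ⟨-, hb⟩
    · push_cast at hb; linarith
    · exact absurd hb (by simp)
  rw [space_form_apply]
  refine Finset.sum_eq_zero fun c _ => ?_
  by_contra hne
  have h2 := right_ne_zero_of_mul hne
  obtain ⟨a, ha, hac⟩ := exists_of_endo_pow_apply_ne_zero (left_ne_zero_of_mul h2)
  have hc := right_ne_zero_of_mul h2
  have hs := shift_eq_none_of_endo_pow_eq_zero hk hc
  have hs' := shift_eq_none_of_endo_pow_eq_zero hk ha
  have hd := hx a ha
  rcases a with a | a <;> rcases c with c | c <;>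
    simp only [shift, finShift_eq, Option.map_eq_some_iff, Sum.inl.injEq, Sum.inr.injEq,
      exists_eq_right, reduceCtorEq, and_false, exists_false] at hac <;>
    simp only [shift, inv, Option.map_eq_none_iff, finShift_eq_none, Fin.val_rev] at hs hs' <;>
    have hc' := c.2 <;>
    have ha0 : a.val = 0 := by omega
  · have hl' : l = 2 * p + 1 := by omega
    refine hl hl' ?_
    simpa [deg, ha0] using hd
  · have hl' : l = 2 * p + 1 := by omega
    refine hl hl' ?_
    have hlq : (l : ℚ) = 2 * p + 1 := by rw [hl']; push_cast; ring
    simp only [deg, ha0, hlq] at hd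
    push_cast at hd
    linarith

/-- The degree condition says `q = p + a`, so `q ≥ p`; vanishing after `2p + 2` steps says `q ≤ p`.
-/
theorem eq_zero_of_string_shift {p q : ℕ} {a : Fin (2 * q + 2)}
    (hd : (q : ℚ) + 1 / 2 - (a.val : ℚ) = (p : ℚ) + 1 / 2)
    (hs : finShift (2 * p + 2) a = none) : q = p ∧ a.val = 0 := by
  rw [finShift_eq_none] at hs
  have : (q : ℚ) = p + a.val := by linarith
  have : q = p + a.val := by exact_mod_cast this
  omega

theorem string_form_single [CharZero K] (p : ℕ) {b : BlockLabel} {first last : b.Index}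
    (hs : b.shift (2 * p + 1) first = some last) (hinv : ∀ c, b.inv c = first ↔ c = last)
    (hsgn : b.sgn last = (-1) ^ p) (u : K) :
    (b.space K).form ((b.endo K ^ (2 * p + 1)) (Pi.single first u)) (Pi.single first u) =
      (b.coeff : K) ^ (2 * p + 1) * (-1) ^ p * (u * u) := by
  rw [space_form_apply, Finset.sum_eq_single last]
  · rw [endo_pow_apply_of_shift_eq hs, (hinv last).2 rfl, hsgn, Pi.single_eq_same]
    push_cast
    ring
  · intro c _ hc
    rw [Pi.single_eq_of_ne (fun h => hc ((hinv c).1 h)), mul_zero, mul_zero]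
  · simp

theorem finRev_eq_zero_iff {p : ℕ} (c : Fin (2 * p + 2)) : c.rev = 0 ↔ c = Fin.last _ := by
  rw [← Fin.rev_last, Fin.rev_inj]

theorem finShift_zero_last (p : ℕ) :
    finShift (2 * p + 1) (0 : Fin (2 * p + 2)) = some (Fin.last _) := by
  simp [finShift_eq]

theorem sgn_last (p : ℕ) : (-1 : ℤ) ^ ((Fin.last (2 * p + 1)).val + p + 1) = (-1) ^ p := by
  rw [Fin.val_last, show 2 * p + 1 + p + 1 = 2 * (p + 1) + p by ring, pow_add, pow_mul]
  simp

theorem tau_form_single [CharZero K] (p : ℕ) (u : K) :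
    ((tau p).space K).form (((tau p).endo K ^ (2 * p + 1))
      (Pi.single (0 : Fin (2 * p + 2)) u : Fin (2 * p + 2) → K))
      (Pi.single (0 : Fin (2 * p + 2)) u : Fin (2 * p + 2) → K) = (-1) ^ p * (u * u) := by
  refine (string_form_single (b := tau p) p (finShift_zero_last p) finRev_eq_zero_iff
    (sgn_last p) u).trans ?_
  simp [coeff]

theorem negTau_form_single [CharZero K] (p : ℕ) (u : K) :
    ((negTau p).space K).form (((negTau p).endo K ^ (2 * p + 1))
      (Pi.single (0 : Fin (2 * p + 2)) u : Fin (2 * p + 2) → K))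
      (Pi.single (0 : Fin (2 * p + 2)) u : Fin (2 * p + 2) → K) = - ((-1) ^ p * (u * u)) := by
  refine (string_form_single (b := negTau p) p (finShift_zero_last p) finRev_eq_zero_iff
    (sgn_last p) u).trans ?_
  have : ((-1 : K)) ^ (2 * p + 1) = -1 := Odd.neg_one_pow ⟨p, rfl⟩
  simp [coeff, this]

variable (K) in
/-- The highest vector of a block `τ_m`, and zero for the other blocks. -/
def topVector : ∀ b : BlockLabel, b.Index → K
  | delta _ _ => 0
  | tau p => (Pi.single (0 : Fin (2 * p + 2)) 1 : Fin (2 * p + 2) → K)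
  | negTau _ => 0

variable (K) in
/-- The coordinate along the highest vector of a block `τ_m`, and zero for the other blocks. -/
def topCoordinate : ∀ b : BlockLabel, (b.Index → K) →ₗ[K] K
  | delta _ _ => 0
  | tau p => LinearMap.proj (R := K) (φ := fun _ : Fin (2 * p + 2) => K) 0
  | negTau _ => 0

theorem topVector_mem [CharZero K] {b : BlockLabel} {p : ℕ} (hb : b = tau p) :
    topVector K b ∈ (b.space K).component ((p : ℚ) + 1 / 2) := by
  subst hb
  intro a ha
  change Fin (2 * p + 2) at a
  have : a = 0 := by
    by_contra h
    exact ha (Pi.single_eq_of_ne h _)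
  subst this
  simp [deg]

theorem endo_pow_topVector {b : BlockLabel} {p : ℕ} (hb : b = tau p) :
    (b.endo K ^ (2 * p + 2)) (topVector K b) = 0 := by
  subst hb
  refine (endo_pow_single (K := K) (tau p) (2 * p + 2) (0 : Fin (2 * p + 2))).trans ?_
  have : (tau p).shift (2 * p + 2) (0 : Fin (2 * p + 2)) = none :=
    (finShift_eq_none _).2 (by simp)
  rw [this]
  rfl

theorem topVector_form [CharZero K] {b : BlockLabel} {p : ℕ} (hb : b = tau p) :
    (b.space K).form ((b.endo K ^ (2 * p + 1)) (topVector K b)) (topVector K b) = (-1) ^ p := by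
  subst hb
  exact (tau_form_single (K := K) p 1).trans (by simp)

/-- On the kernel of `δ^(2p+2)` in degree `p + 1/2`, the form `(-1)^p B_(2p+1)` sees only the top
coordinates of the blocks `±τ` of label `p`: a positive square on `τ`, a negative one on `-τ`. Once
the `τ` coordinate vanishes, nothing positive is left. -/
theorem form_nonpos {b : BlockLabel} (hb : b.Admissible) {p : ℕ} {x : b.Index → ℝ}
    (hx : x ∈ (b.space ℝ).component ((p : ℚ) + 1 / 2)) (hk : (b.endo ℝ ^ (2 * p + 2)) x = 0)
    (htop : b = tau p → topCoordinate ℝ b x = 0) :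
    (-1) ^ p * (b.space ℝ).form ((b.endo ℝ ^ (2 * p + 1)) x) x ≤ 0 := by
  have hzero : x = 0 → (-1) ^ p * (b.space ℝ).form ((b.endo ℝ ^ (2 * p + 1)) x) x ≤ 0 := by
    rintro rfl; simp
  have hsupp : ∀ a, x a ≠ 0 → b.deg a = (p : ℚ) + 1 / 2 ∧ b.shift (2 * p + 2) a = none :=
    fun a ha => ⟨hx a ha, shift_eq_none_of_endo_pow_eq_zero hk ha⟩
  rcases b with ⟨s, l⟩ | q | q
  · rw [delta_form_eq_zero hb hx hk, mul_zero]
  · refine hzero (funext fun (a : Fin (2 * q + 2)) => ?_)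
    by_contra ha
    obtain ⟨hqp, ha0⟩ := eq_zero_of_string_shift (hsupp a ha).1 (hsupp a ha).2
    have h0 : a = 0 := Fin.ext ha0
    rw [h0] at ha
    exact ha (htop (by rw [hqp]))
  · by_cases hqp : q = p
    · subst hqp
      have : x = (Pi.single (0 : Fin (2 * q + 2)) (x (0 : Fin (2 * q + 2))) :
          Fin (2 * q + 2) → ℝ) := by
        funext (a : Fin (2 * q + 2))
        by_cases ha : a = 0
        · rw [ha, Pi.single_eq_same]
        · rw [Pi.single_eq_of_ne ha]
          by_contra hxa
          exact ha (Fin.ext (eq_zero_of_string_shift (hsupp a hxa).1 (hsupp a hxa).2).2)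
      rw [this, negTau_form_single, mul_neg, ← mul_assoc, ← mul_pow]
      have := mul_self_nonneg (x (0 : Fin (2 * q + 2)))
      simpa using this
    · refine hzero (funext fun (a : Fin (2 * q + 2)) => ?_)
      by_contra ha
      exact hqp (eq_zero_of_string_shift (hsupp a ha).1 (hsupp a ha).2).1

/-- If a direct sum of blocks over the real numbers embeds in another one, then the second one
contains at least as many blocks `τ_m` as the first. -/
theorem multiplicity_tau_le {N N' : ℕ} {t : Fin N → BlockLabel} {t' : Fin N' → BlockLabel}
    (ht' : ∀ j, (t' j).Admissible) {φ : (∀ j, (t j).Index → ℝ) →ₗ[ℝ] ∀ j, (t' j).Index → ℝ}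
    (hφ : GradedSymplecticSpace.IsEmbedding (sumSpace ℝ t) (sumEndo ℝ t) (sumSpace ℝ t')
      (sumEndo ℝ t') φ) (p : ℕ) :
    multiplicity t (tau p) ≤ multiplicity t' (tau p) := by
  classical
  -- The span of the top vectors of all the blocks `τ_m` in `t`, on which the quadratic form is a
  -- sum of squares.
  let A : ({j // t j = tau p} → ℝ) →ₗ[ℝ] ∀ j, (t j).Index → ℝ := LinearMap.pi fun j =>
    (if h : t j = tau p then LinearMap.proj (R := ℝ) (φ := fun _ : {j // t j = tau p} => ℝ) ⟨j, h⟩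
      else 0).smulRight (topVector ℝ (t j))
  have hA1 : ∀ c j (h : t j = tau p), A c j = c ⟨j, h⟩ • topVector ℝ (t j) := fun c j h => by
    simp [A, h]
  have hA0 : ∀ c j, t j ≠ tau p → A c j = 0 := fun c j h => by
    simp [A, h]
  have hAmem : ∀ c, A c ∈ (sumSpace ℝ t).component ((p : ℚ) + 1 / 2) := fun c j _ => by
    by_cases h : t j = tau p
    · rw [hA1 c j h]
      exact Submodule.smul_mem _ _ (topVector_mem h)
    · rw [hA0 c j h]
      exact Submodule.zero_mem _
  have hAker : ∀ c, (sumEndo ℝ t ^ (2 * p + 2)) (A c) = 0 := fun c => by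
    funext j
    rw [sumEndo_pow_apply]
    by_cases h : t j = tau p
    · rw [hA1 c j h, map_smul, endo_pow_topVector h, smul_zero]
      rfl
    · rw [hA0 c j h, map_zero]
      rfl
  have hAform : ∀ c, (-1) ^ p * (sumSpace ℝ t).form ((sumEndo ℝ t ^ (2 * p + 1)) (A c)) (A c) =
      ∑ j, if h : t j = tau p then c ⟨j, h⟩ ^ 2 else 0 := fun c => by
    change (-1) ^ p * ∑ j, ((t j).space ℝ).form ((sumEndo ℝ t ^ (2 * p + 1)) (A c) j) (A c j) = _
    rw [Finset.mul_sum]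
    refine Finset.sum_congr rfl fun j _ => ?_
    rw [sumEndo_pow_apply]
    split_ifs with h
    · rw [hA1 c j h]
      simp only [map_smul, LinearMap.smul_apply, topVector_form h, smul_eq_mul]
      have : ((-1 : ℝ)) ^ p * (-1) ^ p = 1 := by rw [← mul_pow]; simp
      linear_combination (c ⟨j, h⟩) ^ 2 * this
    · rw [hA0 c j h, map_zero, mul_zero]
  let B : ({j // t j = tau p} → ℝ) →ₗ[ℝ] ({j // t' j = tau p} → ℝ) := LinearMap.pi fun j =>
    topCoordinate ℝ (t' j) ∘ₗ LinearMap.proj (R := ℝ) (φ := fun j => (t' j).Index → ℝ) j.1 ∘ₗ φ ∘ₗ A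
  have hB : Function.Injective B := by
    rw [injective_iff_map_eq_zero]
    intro c hc
    have hle : (-1) ^ p * (sumSpace ℝ t).form ((sumEndo ℝ t ^ (2 * p + 1)) (A c)) (A c) ≤ 0 := by
      rw [← hφ.form_map, hφ.pow_comm]
      change (-1) ^ p * ∑ j, ((t' j).space ℝ).form ((sumEndo ℝ t' ^ (2 * p + 1)) (φ (A c)) j)
        (φ (A c) j) ≤ 0
      rw [Finset.mul_sum]
      refine Finset.sum_nonpos fun j _ => ?_
      rw [sumEndo_pow_apply]
      refine form_nonpos (ht' j) (hφ.map_mem _ _ (hAmem c) j trivial) ?_ fun h => ?_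
      · rw [← sumEndo_pow_apply, ← hφ.pow_comm, hAker, map_zero]
        rfl
      · exact congr_fun hc ⟨j, h⟩
    rw [hAform] at hle
    have hnn : ∀ j ∈ Finset.univ, 0 ≤ if h : t j = tau p then c ⟨j, h⟩ ^ 2 else 0 := by
      intro j _
      split_ifs
      · positivity
      · exact le_rfl
    have hz := (Finset.sum_eq_zero_iff_of_nonneg hnn).1 (le_antisymm hle (Finset.sum_nonneg hnn))
    funext ⟨j, h⟩
    have := hz j (Finset.mem_univ j)
    rw [dif_pos h] at this
    exact pow_eq_zero_iff two_ne_zero |>.1 this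
  have := LinearMap.finrank_le_finrank_of_injective hB
  rwa [Module.finrank_fintype_fun_eq_card, Module.finrank_fintype_fun_eq_card,
    ← Nat.card_eq_fintype_card, ← Nat.card_eq_fintype_card] at this

end Signature

end BlockLabel

/-- The multiplicities of admissible blocks in direct sums conjugate to two given endomorphisms
agree if and only if these endomorphisms are conjugate, provided that the multiplicities of the
blocks `τ_m` and `-τ_m` are determined by the conjugacy class of a direct sum. -/
theorem isConj_iff_multiplicity_eq {K V : Type*} [Field K] [CharZero K] [AddCommGroup V]
    [Module K V] {S : GradedSymplecticSpace K V} {δ δ' : Module.End K V} {N N' : ℕ}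
    {t : Fin N → BlockLabel} {t' : Fin N' → BlockLabel} (ht : ∀ j, (t j).Admissible)
    (ht' : ∀ j, (t' j).Admissible)
    (h : S.IsConj δ (BlockLabel.sumSpace K t) (BlockLabel.sumEndo K t))
    (h' : S.IsConj δ' (BlockLabel.sumSpace K t') (BlockLabel.sumEndo K t'))
    (htau : (BlockLabel.sumSpace K t).IsConj (BlockLabel.sumEndo K t) (BlockLabel.sumSpace K t')
      (BlockLabel.sumEndo K t') → ∀ p, BlockLabel.multiplicity t (BlockLabel.tau p) =
        BlockLabel.multiplicity t' (BlockLabel.tau p)) :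
    S.IsConj δ S δ' ↔ ∀ b, BlockLabel.multiplicity t b = BlockLabel.multiplicity t' b := by
  constructor
  · intro hc
    have hsum := h.symm.trans (hc.trans h')
    rintro (⟨s, l⟩ | p | p)
    · exact BlockLabel.multiplicity_delta_eq ht ht' hsum s l
    · exact htau hsum p
    · have h1 := htau hsum p
      have h2 := BlockLabel.multiplicity_tau_add_eq ht ht' hsum p
      omega
  · intro hm
    exact h.trans ((BlockLabel.isConj_sum_of_multiplicity_eq K hm).trans h'.symm)

/-! ### The three cases of the classification -/

theorem theorem6p2 :
    -- grading indexed by the integers, over the real or the complex numbers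
    (∀ (K : Type*) [RCLike K] (V : Type*) [AddCommGroup V] [Module K V] [FiniteDimensional K V]
      (S : GradedSymplecticSpace K V), S.DegreesIn integerDegrees →
      (∀ δ ∈ S.spDegreeNegOne, ∃ (N : ℕ) (t : Fin N → BlockLabel),
        (∀ j, t j ∈ BlockLabel.integerLabels) ∧
        S.IsConj δ (BlockLabel.sumSpace K t) (BlockLabel.sumEndo K t)) ∧
      (∀ δ ∈ S.spDegreeNegOne, ∀ δ' ∈ S.spDegreeNegOne,
        ∀ (N N' : ℕ) (t : Fin N → BlockLabel) (t' : Fin N' → BlockLabel),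
        (∀ j, t j ∈ BlockLabel.integerLabels) → (∀ j, t' j ∈ BlockLabel.integerLabels) →
        S.IsConj δ (BlockLabel.sumSpace K t) (BlockLabel.sumEndo K t) →
        S.IsConj δ' (BlockLabel.sumSpace K t') (BlockLabel.sumEndo K t') →
        (S.IsConj δ S δ' ↔
          ∀ b, BlockLabel.multiplicity t b = BlockLabel.multiplicity t' b))) ∧
    -- grading indexed by the half-odd integers, over the complex numbers
    (∀ (V : Type*) [AddCommGroup V] [Module ℂ V] [FiniteDimensional ℂ V]
      (S : GradedSymplecticSpace ℂ V), S.DegreesIn halfOddDegrees →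
      (∀ δ ∈ S.spDegreeNegOne, ∃ (N : ℕ) (t : Fin N → BlockLabel),
        (∀ j, t j ∈ BlockLabel.halfOddDeltaLabels ∪ BlockLabel.tauLabels) ∧
        S.IsConj δ (BlockLabel.sumSpace ℂ t) (BlockLabel.sumEndo ℂ t)) ∧
      (∀ δ ∈ S.spDegreeNegOne, ∀ δ' ∈ S.spDegreeNegOne,
        ∀ (N N' : ℕ) (t : Fin N → BlockLabel) (t' : Fin N' → BlockLabel),
        (∀ j, t j ∈ BlockLabel.halfOddDeltaLabels ∪ BlockLabel.tauLabels) →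
        (∀ j, t' j ∈ BlockLabel.halfOddDeltaLabels ∪ BlockLabel.tauLabels) →
        S.IsConj δ (BlockLabel.sumSpace ℂ t) (BlockLabel.sumEndo ℂ t) →
        S.IsConj δ' (BlockLabel.sumSpace ℂ t') (BlockLabel.sumEndo ℂ t') →
        (S.IsConj δ S δ' ↔
          ∀ b, BlockLabel.multiplicity t b = BlockLabel.multiplicity t' b))) ∧
    -- grading indexed by the half-odd integers, over the real numbers
    (∀ (V : Type*) [AddCommGroup V] [Module ℝ V] [FiniteDimensional ℝ V]
      (S : GradedSymplecticSpace ℝ V), S.DegreesIn halfOddDegrees →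
      (∀ δ ∈ S.spDegreeNegOne, ∃ (N : ℕ) (t : Fin N → BlockLabel),
        (∀ j, t j ∈ BlockLabel.halfOddDeltaLabels ∪ BlockLabel.tauLabels ∪
          BlockLabel.negTauLabels) ∧
        S.IsConj δ (BlockLabel.sumSpace ℝ t) (BlockLabel.sumEndo ℝ t)) ∧
      (∀ δ ∈ S.spDegreeNegOne, ∀ δ' ∈ S.spDegreeNegOne,
        ∀ (N N' : ℕ) (t : Fin N → BlockLabel) (t' : Fin N' → BlockLabel),
        (∀ j, t j ∈ BlockLabel.halfOddDeltaLabels ∪ BlockLabel.tauLabels ∪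
          BlockLabel.negTauLabels) →
        (∀ j, t' j ∈ BlockLabel.halfOddDeltaLabels ∪ BlockLabel.tauLabels ∪
          BlockLabel.negTauLabels) →
        S.IsConj δ (BlockLabel.sumSpace ℝ t) (BlockLabel.sumEndo ℝ t) →
        S.IsConj δ' (BlockLabel.sumSpace ℝ t') (BlockLabel.sumEndo ℝ t') →
        (S.IsConj δ S δ' ↔
          ∀ b, BlockLabel.multiplicity t b = BlockLabel.multiplicity t' b))) := by
  have hint : ∀ (p : ℕ) {N : ℕ} {t : Fin N → BlockLabel}, (∀ j, t j ∈ BlockLabel.integerLabels) →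
      BlockLabel.multiplicity t (BlockLabel.tau p) = 0 := by
    refine fun p N t ht => BlockLabel.multiplicity_eq_zero fun j hj => ?_
    obtain ⟨k, l, -, hkl⟩ := ht j
    rw [hj] at hkl
    cases hkl
  have hcneg : ∀ (p : ℕ) {N : ℕ} {t : Fin N → BlockLabel},
      (∀ j, t j ∈ BlockLabel.halfOddDeltaLabels ∪ BlockLabel.tauLabels) →
      BlockLabel.multiplicity t (BlockLabel.negTau p) = 0 := by
    refine fun p N t ht => BlockLabel.multiplicity_eq_zero fun j hj => ?_
    rcases ht j with ⟨k, l, -, hkl⟩ | ⟨q, hq⟩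
    · rw [hj] at hkl; cases hkl
    · rw [hj] at hq; cases hq
  have hcadm : ∀ {b}, b ∈ BlockLabel.halfOddDeltaLabels ∪ BlockLabel.tauLabels →
      b.Admissible := by
    rintro b (hb | ⟨p, rfl⟩)
    · exact BlockLabel.admissible_of_mem_halfOddDeltaLabels hb
    · trivial
  have hradm : ∀ {b}, b ∈ BlockLabel.halfOddDeltaLabels ∪ BlockLabel.tauLabels ∪
      BlockLabel.negTauLabels → b.Admissible := by
    rintro b (hb | ⟨p, rfl⟩)
    · exact hcadm hb
    · trivial
  refine ⟨?_, ?_, ?_⟩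
  · intro K _ V _ _ _ S hD
    refine ⟨GradedSymplecticSpace.exists_isConj_sum
      (fun V _ _ _ _ => GradedSymplecticSpace.exists_integer_block) V S hD, ?_⟩
    intro δ _ δ' _ N N' t t' ht ht' h h'
    exact isConj_iff_multiplicity_eq
      (fun j => BlockLabel.admissible_of_mem_integerLabels (ht j))
      (fun j => BlockLabel.admissible_of_mem_integerLabels (ht' j)) h h'
      fun _ p => by rw [hint p ht, hint p ht']
  · intro V _ _ _ S hD
    refine ⟨GradedSymplecticSpace.exists_isConj_sum
      (fun V _ _ _ _ => GradedSymplecticSpace.exists_complex_block) V S hD, ?_⟩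
    intro δ _ δ' _ N N' t t' ht ht' h h'
    refine isConj_iff_multiplicity_eq (fun j => hcadm (ht j)) (fun j => hcadm (ht' j)) h h'
      fun hsum p => ?_
    -- Over the complex numbers `-τ_m` is not on the list, so the total multiplicity is already that
    -- of `τ_m`.
    have := BlockLabel.multiplicity_tau_add_eq (fun j => hcadm (ht j)) (fun j => hcadm (ht' j))
      hsum p
    rwa [hcneg p ht, hcneg p ht'] at this
  · intro V _ _ _ S hD
    refine ⟨GradedSymplecticSpace.exists_isConj_sum
      (fun V _ _ _ _ => GradedSymplecticSpace.exists_real_block) V S hD, ?_⟩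
    intro δ _ δ' _ N N' t t' ht ht' h h'
    refine isConj_iff_multiplicity_eq (fun j => hradm (ht j)) (fun j => hradm (ht' j)) h h'
      fun hsum p => ?_
    -- The inertia inequality is applied to the conjugation and to its inverse.
    obtain ⟨φ, hφ, -⟩ := hsum.exists_isEmbedding
    obtain ⟨ψ, hψ, -⟩ := hsum.symm.exists_isEmbedding
    exact le_antisymm (BlockLabel.multiplicity_tau_le (fun j => hradm (ht' j)) hφ p)
      (BlockLabel.multiplicity_tau_le (fun j => hradm (ht j)) hψ p)
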